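/- Let $D=(V,A)$ be a finite directed graph (parallel arcs allowed) with arc capacities $c\in\mathbb{R}_{\ge 0}^A$ and a balance function $b\colon V\to\mathbb{R}$ with $\sum_{v\in V}b(v)=0$. Let $S^+=\{v: b(v)>0\}$ be the set of sources and $S^-=\{v: b(v)<0\}$ the set of sinks, and put $d_{\max}=\max_{t\in S^-}|b(t)|$ and $c_{\min}=\min_{a\in A}c_a$ (each read as $0$ if the maximum or minimum is over the empty set). For a balance function $b'\colon V\to\mathbb{R}$, a $b'$-transshipment is a vector $x\in\mathbb{R}_{\ge 0}^A$ with $\sum_{a\in\delta^{\mathrm{out}}(v)}x_a-\sum_{a\in\delta^{\mathrm{in}}(v)}x_a=b'(v)$ for all $v\in V$; it is feasible if $x_a\le c_a$ for all $a\in A$; it is unsplittable if it comes with a decomposition into flows along directed (simple) paths, each from a source of $b'$ to a sink of $b'$, with at most one path for each source--sink pair. We say that all demands can be routed unsplittably in $k$ feasible rounds if $S^-$ can be partitioned into $k$ (possibly empty) sets $T_1,\dots,T_k$ and there are balance functions $b_1,\dots,b_k\colon V\to\mathbb{R}$ such that, for every $i$, $b_i(t)=b(t)$ for $t\in T_i$,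 $b_i(s)\ge 0$ for $s\in S^+$, and $b_i(v)=0$ for all other vertices $v$; $\sum_{i=1}^k b_i(s)=b(s)$ for every $s\in S^+$; and for every $i$ there is a feasible unsplittable $b_i$-transshipment. Assume that a feasible $b$-transshipment exists. If $d_{\max}\le c_{\min}/3$, then all demands can be routed unsplittably in six feasible rounds. If $d_{\max}\le c_{\min}/4$, then all demands can be routed unsplittably in four feasible rounds. -/

import Mathlib

/-- A directed multigraph with vertex type `V` and arc type `A`: the arc `a` leads from
`src a` to `tgt a`. Parallel arcs, loops and directed cycles are allowed. -/
structure ArcDigraph (V A : Type*) where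
  src : A → V
  tgt : A → V

namespace ArcDigraph

/-- The sources `S⁺` of a balance function. -/
def sources {V : Type*} (b : V → ℝ) : Set V := {v | 0 < b v}

/-- The sinks `S⁻` of a balance function. -/
def sinks {V : Type*} (b : V → ℝ) : Set V := {v | b v < 0}

/-- The maximum demand `d_max = max_{t ∈ S⁻} |b(t)|` (it is `0` if there is no sink). -/
noncomputable def dMax {V : Type*} (b : V → ℝ) : ℝ := ⨆ t : sinks b, |b t|

/-- The minimum arc capacity `c_min = min_{a ∈ A} c_a` (it is `0` if there is no arc). -/
noncomputable def cMin {A : Type*} (c : A → ℝ) : ℝ := ⨅ a, c a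

/-- `x` is a (fractional) `b`-transshipment: it is nonnegative and at every vertex the
outflow minus the inflow is the balance of the vertex. -/
def IsTransshipment {V A : Type*} [Fintype A] [DecidableEq V]
    (D : ArcDigraph V A) (b : V → ℝ) (x : A → ℝ) : Prop :=
  (∀ a, 0 ≤ x a) ∧
    ∀ v, (∑ a with D.src a = v, x a) - (∑ a with D.tgt a = v, x a) = b v

/-- The flow `x` respects the arc capacities `c`. -/
def IsFeasible {A : Type*} (c x : A → ℝ) : Prop := ∀ a, x a ≤ c a

/-- The list of arcs `p` is a directed walk from `u` to `v`. -/
def IsWalk {V A : Type*} (D : ArcDigraph V A) : V → V → List A → Prop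
  | u, v, [] => u = v
  | u, v, a :: p => D.src a = u ∧ D.IsWalk (D.tgt a) v p

/-- The list of arcs `p` is a directed path from `u` to `v`: a directed walk that visits
no vertex twice. -/
def IsPath {V A : Type*} (D : ArcDigraph V A) (u v : V) (p : List A) : Prop :=
  D.IsWalk u v p ∧ (u :: p.map D.tgt).Nodup

/-- An unsplittable `b`-transshipment: a `b`-transshipment `flow` together with a path
decomposition into source-sink paths, with at most one path for each source-sink pair.
The pair `(s, t)` is served along `path s t` with flow value `amount s t`; if the amount is
zero then no path is used and the list `path s t` is irrelevant. -/
structure UnsplittableTransshipment {V A : Type*} [Fintype V] [Fintype A] [DecidableEq V]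
    [DecidableEq A] (D : ArcDigraph V A) (b : V → ℝ) where
  flow : A → ℝ
  isTransshipment : D.IsTransshipment b flow
  amount : V → V → ℝ
  path : V → V → List A
  amount_nonneg : ∀ s t, 0 ≤ amount s t
  path_spec : ∀ s t, 0 < amount s t → s ∈ sources b ∧ t ∈ sinks b ∧ D.IsPath s t (path s t)
  flow_eq : ∀ a, flow a = ∑ s, ∑ t, if a ∈ path s t then amount s t else 0

/-- All demands can be routed unsplittably in `k` feasible rounds: the set of sinks is
partitioned into `k` (possibly empty) classes, `round t` being the class of the sink `t`, and
for each class `i` there is a feasible unsplittable transshipment with respect to a balance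
function `bal i` in which exactly the sinks of class `i` have their full demand and the other
sinks have none. The sources supply some nonnegative amount in each round, and over all
rounds every source supplies exactly its prescribed supply. -/
def RoutableInRounds {V A : Type*} [Fintype V] [Fintype A] [DecidableEq V] [DecidableEq A]
    (D : ArcDigraph V A) (b : V → ℝ) (c : A → ℝ) (k : ℕ) : Prop :=
  ∃ (round : sinks b → Fin k) (bal : Fin k → V → ℝ),
    (∀ i, ∀ t : sinks b, bal i t = if round t = i then b t else 0) ∧
    (∀ i, ∀ v, b v = 0 → bal i v = 0) ∧
    (∀ i, ∀ s ∈ sources b, 0 ≤ bal i s) ∧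
    (∀ s ∈ sources b, ∑ i, bal i s = b s) ∧
    ∀ i, ∃ y : D.UnsplittableTransshipment (bal i), IsFeasible c y.flow

end ArcDigraph

namespace ArcDigraph

/-! After cancelling directed cycles the flow x is acyclic. Half of it is sent through each of two
disjoint copies (layers) of the digraph, every source and every sink being attached to both layers.
A rounding procedure turns this flow into a routing with one path per source-sink pair. It assigns
to every sink `t` a layer `lay t` and an amount `q t` such that `t` puts a load of at most `q t` on
any arc of its own layer and at most its demand minus `q t` on any arc of the other one. On the copy
of an arc a in a layer, the sinks of this layer with `q t ≤ β` have total load at most x_a/2 + β,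
and at most one sink of the other layer uses the arc.

Consequently, sinks of one layer with `q t ≤ β` and demand minus `q t` at most γ load an arc a of
the original digraph by at most x_a/2 + β + γ (`exists_two_class_routing`). With β = γ = d_max, the
two layers are two feasible rounds if d_max ≤ c_min/4. Splitting each layer according to whether `q
t` exceeds half of the demand makes β or γ equal to d_max/2, and these four rounds are feasible if
d_max ≤ c_min/3. This is stronger than what is claimed; the remaining rounds stay empty.

The rounding procedure (`FlowState.Valid.routable`) applies three operations. A sink moves backwards
along an arc that carries its whole demand. If no sink can move, consider the regular vertices, from
which no branching vertex can be reached: those leading to a given end of the flow form a tree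
directed towards this end. If at most one arc enters some tree, the flow inside is decomposed into
source-sink contributions, and the demand not yet served, which equals the inflow, moves to the tail
of the entering arc. If every tree has two entries, Hall's theorem yields a circulation that
increases the flow only on arcs with regular heads; it is pushed until an arc dies or its flow
reaches the demand of a sink at its head. Arcs whose flow may have grown are closed: on them the
sinks of the layer have to fit into β alone, so the bound never refers to the increased flow. -/

open scoped Classical in
theorem card_filter_lt_card_filter {α : Type*} [Fintype α] {P Q : α → Prop}
    (h : ∀ x, P x → Q x) (h' : ∃ x, Q x ∧ ¬ P x) :
    (Finset.univ.filter P).card < (Finset.univ.filter Q).card := by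
  apply Finset.card_lt_card
  obtain ⟨x, hx, hx'⟩ := h'
  refine ⟨fun y hy => ?_, fun hh => ?_⟩
  · simp only [Finset.mem_filter, Finset.mem_univ, true_and] at hy ⊢; exact h y hy
  · have := hh (by simpa using hx : x ∈ Finset.univ.filter Q)
    exact hx' (by simpa using this)

open scoped Classical in
theorem card_filter_le_card_filter {α : Type*} [Fintype α] {P Q : α → Prop}
    (h : ∀ x, P x → Q x) :
    (Finset.univ.filter P).card ≤ (Finset.univ.filter Q).card :=
  Finset.card_le_card fun y hy => by
    simp only [Finset.mem_filter, Finset.mem_univ, true_and] at hy ⊢; exact h y hy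

/-! ### Net outflow and weight located at a vertex -/

section Net

variable {V A : Type*} [Fintype A] [DecidableEq V] (D : ArcDigraph V A)

/-- The net outflow of `f` at `v`. -/
def net (f : A → ℝ) (v : V) : ℝ :=
  ∑ a, ((if D.src a = v then f a else 0) - (if D.tgt a = v then f a else 0))

theorem net_eq_sub (f : A → ℝ) (v : V) :
    D.net f v = (∑ a with D.src a = v, f a) - ∑ a with D.tgt a = v, f a := by
  simp [net, Finset.sum_sub_distrib, Finset.sum_filter]

theorem net_add (f g : A → ℝ) (v : V) :
    D.net (fun a => f a + g a) v = D.net f v + D.net g v := by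
  unfold net; rw [← Finset.sum_add_distrib]
  refine Finset.sum_congr rfl fun a _ => ?_
  split_ifs <;> ring

theorem net_sub (f g : A → ℝ) (v : V) :
    D.net (fun a => f a - g a) v = D.net f v - D.net g v := by
  unfold net; rw [← Finset.sum_sub_distrib]
  refine Finset.sum_congr rfl fun a _ => ?_
  split_ifs <;> ring

theorem net_smul (c : ℝ) (f : A → ℝ) (v : V) :
    D.net (fun a => c * f a) v = c * D.net f v := by
  unfold net; rw [Finset.mul_sum]
  refine Finset.sum_congr rfl fun a _ => ?_
  split_ifs <;> ring

theorem net_sum {ι : Type*} (s : Finset ι) (f : ι → A → ℝ) (v : V) :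
    D.net (fun a => ∑ i ∈ s, f i a) v = ∑ i ∈ s, D.net (f i) v := by
  classical
  induction s using Finset.induction_on with
  | empty => simp [net]
  | insert i s hi ih => simp only [Finset.sum_insert hi, net_add, ih]

theorem net_single [DecidableEq A] (e : A) (c : ℝ) (v : V) :
    D.net (fun a => if a = e then c else 0) v =
      (if D.src e = v then c else 0) - (if D.tgt e = v then c else 0) := by
  unfold net
  rw [Finset.sum_eq_single e]
  · simp
  · intro b _ hb; simp [hb]
  · simp

theorem sum_mul_net [Fintype V] (g : V → ℝ) (f : A → ℝ) :
    ∑ v, g v * D.net f v = ∑ a, f a * (g (D.src a) - g (D.tgt a)) := by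
  unfold net
  simp_rw [Finset.mul_sum]
  rw [Finset.sum_comm]
  refine Finset.sum_congr rfl fun a _ => ?_
  simp only [mul_sub, Finset.sum_sub_distrib, mul_ite, mul_zero]
  simp [mul_comm]

/-- The total weight located at `v`. -/
def massAt {S : Type*} [Fintype S] (p : S → V) (g : S → ℝ) (v : V) : ℝ :=
  ∑ s, if p s = v then g s else 0

theorem massAt_nonneg {S : Type*} [Fintype S] {p : S → V} {g : S → ℝ} (hg : ∀ s, 0 ≤ g s)
    (v : V) : 0 ≤ massAt p g v :=
  Finset.sum_nonneg fun s _ => by split_ifs; exacts [hg s, le_rfl]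

theorem le_massAt {S : Type*} [Fintype S] {p : S → V} {g : S → ℝ} (hg : ∀ s, 0 ≤ g s)
    (s : S) : g s ≤ massAt p g (p s) := by
  have := Finset.single_le_sum (f := fun s' => if p s' = p s then g s' else 0)
    (fun s' _ => by split_ifs; exacts [hg s', le_rfl]) (Finset.mem_univ s)
  simpa [massAt] using this

theorem exists_pos_of_massAt_pos {S : Type*} [Fintype S] {p : S → V} {g : S → ℝ} {v : V}
    (h : 0 < massAt p g v) : ∃ s, p s = v ∧ 0 < g s := by
  by_contra! hh
  refine absurd h (not_lt.2 (Finset.sum_nonpos fun s _ => ?_))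
  split_ifs with h'
  · exact hh s h'
  · exact le_rfl

theorem massAt_eq_zero {S : Type*} [Fintype S] {p : S → V} {g : S → ℝ} {v : V}
    (h : ∀ s, p s = v → g s = 0) : massAt p g v = 0 :=
  Finset.sum_eq_zero fun s _ => by split_ifs with h'; exacts [h s h', rfl]

theorem massAt_sub_single {S : Type*} [Fintype S] [DecidableEq S] (p : S → V) (g : S → ℝ)
    (s₀ : S) (μ : ℝ) (v : V) :
    massAt p (fun s => g s - if s = s₀ then μ else 0) v =
      massAt p g v - if p s₀ = v then μ else 0 := by
  have : (if p s₀ = v then μ else 0) = ∑ s, if s = s₀ then (if p s = v then μ else 0) else 0 := by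
    simp
  rw [this, massAt, massAt, ← Finset.sum_sub_distrib]
  refine Finset.sum_congr rfl fun s _ => ?_
  split_ifs <;> simp

theorem massAt_update {S : Type*} [Fintype S] [DecidableEq S] (p : S → V) (g : S → ℝ)
    (s₀ : S) (y v : V) :
    massAt (Function.update p s₀ y) g v =
      massAt p g v - (if p s₀ = v then g s₀ else 0) + if y = v then g s₀ else 0 := by
  have h : ∀ x : V, (if x = v then g s₀ else 0) =
      ∑ s, if s = s₀ then (if x = v then g s else 0) else 0 := by simp
  rw [h, h, massAt, massAt, ← Finset.sum_sub_distrib, ← Finset.sum_add_distrib]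
  refine Finset.sum_congr rfl fun s _ => ?_
  by_cases hs : s = s₀
  · subst hs; simp
  · simp [hs]

end Net

/-! ### Walks, reachability, ranks and labels -/

section Walk

variable {V A : Type*} {D : ArcDigraph V A}

theorem IsWalk.append {u v w : V} {p q : List A} (hp : D.IsWalk u v p) (hq : D.IsWalk v w q) :
    D.IsWalk u w (p ++ q) := by
  induction p generalizing u with
  | nil => cases hp; exact hq
  | cons a p ih => exact ⟨hp.1, ih hp.2⟩

theorem isWalk_singleton (a : A) : D.IsWalk (D.src a) (D.tgt a) [a] := ⟨rfl, rfl⟩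

/-- Reachability along the arcs of the set `E`. -/
def Reach (D : ArcDigraph V A) (E : Set A) : V → V → Prop :=
  Relation.ReflTransGen fun u v => ∃ a ∈ E, D.src a = u ∧ D.tgt a = v

theorem Reach.refl (E : Set A) (v : V) : D.Reach E v v := Relation.ReflTransGen.refl

theorem Reach.trans {E : Set A} {u v w : V} (h : D.Reach E u v) (h' : D.Reach E v w) :
    D.Reach E u w := Relation.ReflTransGen.trans h h'

theorem reach_arc {E : Set A} {a : A} (h : a ∈ E) : D.Reach E (D.src a) (D.tgt a) :=
  Relation.ReflTransGen.single ⟨a, h, rfl, rfl⟩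

theorem Reach.mono {E F : Set A} (h : E ⊆ F) {u v : V} (hr : D.Reach E u v) : D.Reach F u v :=
  Relation.ReflTransGen.mono (fun _ _ ⟨a, ha, h1, h2⟩ => ⟨a, h ha, h1, h2⟩) _ _ hr

theorem Reach.eq_or_head {E : Set A} {u v : V} (h : D.Reach E u v) :
    u = v ∨ ∃ a ∈ E, D.src a = u ∧ D.Reach E (D.tgt a) v := by
  rcases Relation.ReflTransGen.cases_head h with h | ⟨w, ⟨a, ha, h1, h2⟩, h3⟩
  · exact Or.inl h
  · subst h2; exact Or.inr ⟨a, ha, h1, h3⟩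

theorem Reach.eq_or_tail {E : Set A} {u v : V} (h : D.Reach E u v) :
    u = v ∨ ∃ a ∈ E, D.tgt a = v ∧ D.Reach E u (D.src a) := by
  rcases Relation.ReflTransGen.cases_tail h with h | ⟨w, h3, ⟨a, ha, h1, h2⟩⟩
  · exact Or.inl h.symm
  · subst h1; exact Or.inr ⟨a, ha, h2, h3⟩

theorem Reach.rank_le {E : Set A} {ρ : V → ℕ} (hρ : ∀ a ∈ E, ρ (D.src a) < ρ (D.tgt a))
    {u v : V} (h : D.Reach E u v) : ρ u ≤ ρ v := by
  induction h with
  | refl => exact le_rfl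
  | tail _ h ih => obtain ⟨a, ha, rfl, rfl⟩ := h; exact ih.trans (hρ a ha).le

theorem Reach.eq_of_rank_le {E : Set A} {ρ : V → ℕ}
    (hρ : ∀ a ∈ E, ρ (D.src a) < ρ (D.tgt a))
    {u v : V} (h : D.Reach E u v) (h' : ρ v ≤ ρ u) : u = v := by
  rcases h.eq_or_head with h | ⟨a, ha, rfl, h3⟩
  · exact h
  · have := hρ a ha
    have := h3.rank_le hρ
    omega

/-- Reachability along `E` is total on the vertices reachable from a given vertex from which
only vertices with at most one outgoing arc in `E` can be reached. -/
theorem Reach.total {E : Set A} {u v w : V} (huv : D.Reach E u v) (huw : D.Reach E u w)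
    (hu : ∀ x, D.Reach E u x → ∀ a ∈ E, ∀ a' ∈ E, D.src a = x → D.src a' = x → a = a') :
    D.Reach E v w ∨ D.Reach E w v := by
  induction huv using Relation.ReflTransGen.head_induction_on with
  | refl => exact Or.inl huw
  | head h1 h2 ih =>
    obtain ⟨a, ha, rfl, rfl⟩ := h1
    rcases huw.eq_or_head with rfl | ⟨a', ha', h3, h4⟩
    · exact Or.inr ((reach_arc ha).trans h2)
    · have : a' = a := hu _ (Reach.refl _ _) _ ha' _ ha h3 rfl
      subst this
      exact ih h4 fun x hx => hu x ((reach_arc ha).trans hx)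

theorem Reach.exists_isWalk {E : Set A} {u v : V} (h : D.Reach E u v) :
    ∃ p, D.IsWalk u v p ∧
      ∀ a ∈ p, a ∈ E ∧ D.Reach E u (D.src a) ∧ D.Reach E (D.tgt a) v := by
  induction h using Relation.ReflTransGen.head_induction_on with
  | refl => exact ⟨[], rfl, by simp⟩
  | head h1 h2 ih =>
    obtain ⟨a, ha, rfl, rfl⟩ := h1
    obtain ⟨p, hp, hp'⟩ := ih
    refine ⟨a :: p, ⟨rfl, hp⟩, fun b hb => ?_⟩
    rcases List.mem_cons.1 hb with rfl | hb
    · exact ⟨ha, Reach.refl _ _, h2⟩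
    · obtain ⟨h3, h4, h5⟩ := hp' b hb
      exact ⟨h3, (reach_arc ha).trans h4, h5⟩

/-- The label will be the layer: consecutive arcs share it, so a walk ending at the tail of `b`
stays in the layer of `b`. -/
theorem IsWalk.label_eq {L : Type*} {lab : A → L}
    (hlab : ∀ a a', D.tgt a = D.src a' → lab a = lab a') {u v : V} {p : List A}
    (h : D.IsWalk u v p) {b : A} (hb : D.src b = v) : ∀ a ∈ p, lab a = lab b := by
  induction p generalizing u with
  | nil => simp
  | cons a p ih =>
    obtain ⟨rfl, h2⟩ := h
    have ih' := ih h2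
    intro c hc
    rcases List.mem_cons.1 hc with rfl | hc
    · cases p with
      | nil => cases h2; exact hlab _ _ hb.symm
      | cons d p => rw [hlab c d h2.1.symm]; exact ih' d (by simp)
    · exact ih' c hc

theorem IsWalk.label_const {L : Type*} {lab : A → L}
    (hlab : ∀ a a', D.tgt a = D.src a' → lab a = lab a') {u v : V} {p : List A}
    (h : D.IsWalk u v p) : ∀ a ∈ p, ∀ b ∈ p, lab a = lab b := by
  induction p generalizing u with
  | nil => simp
  | cons a p ih =>
    obtain ⟨rfl, h2⟩ := h
    have key : ∀ c ∈ p, lab a = lab c := by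
      cases p with
      | nil => simp
      | cons d p =>
        intro c hc
        rw [hlab a d h2.1.symm]; exact ih h2 d (by simp) c hc
    intro c hc d hd
    rcases List.mem_cons.1 hc with h3 | h3 <;> rcases List.mem_cons.1 hd with h4 | h4
    · rw [h3, h4]
    · rw [h3]; exact key d h4
    · rw [h4]; exact (key c h3).symm
    · exact ih h2 c h3 d h4

/-- Ranks increase along the walk, so no vertex recurs. This is how walks become simple paths. -/
theorem IsWalk.nodup_of_rank {ρ : V → ℕ} {u v : V} {p : List A} (h : D.IsWalk u v p)
    (hp : ∀ a ∈ p, ρ (D.src a) < ρ (D.tgt a)) :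
    (u :: p.map D.tgt).Nodup ∧ ∀ x ∈ p.map D.tgt, ρ u < ρ x := by
  induction p generalizing u with
  | nil => simp
  | cons a p ih =>
    obtain ⟨rfl, h2⟩ := h
    obtain ⟨h3, h4⟩ := ih h2 fun b hb => hp b (by simp [hb])
    have ha := hp a (by simp)
    have key : ∀ x ∈ (a :: p).map D.tgt, ρ (D.src a) < ρ x := by
      intro x hx
      rw [List.map_cons, List.mem_cons] at hx
      rcases hx with rfl | hx
      · exact ha
      · exact ha.trans (h4 x hx)
    refine ⟨?_, key⟩
    rw [List.nodup_cons]
    exact ⟨fun hm => lt_irrefl _ (key _ hm), by rw [List.map_cons]; exact h3⟩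

end Walk

/-! ### Decomposing a flow without branching -/

section Transport

variable {V A S T : Type*} [Fintype A] [DecidableEq V] [Fintype S] [Fintype T]
  {D : ArcDigraph V A}

open scoped Classical in
/-- A flow on arcs `E` with at most one arc leaving every vertex can be decomposed into
contributions of source-sink pairs. -/
theorem exists_transport {E : Set A} {ρ : V → ℕ}
    (hE : ∀ a ∈ E, ∀ a' ∈ E, D.src a = D.src a' → a = a')
    (hρ : ∀ a ∈ E, ρ (D.src a) < ρ (D.tgt a)) :
    ∀ (n : ℕ) (f : A → ℝ) (ps : S → V) (sup : S → ℝ) (pt : T → V) (dem : T → ℝ),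
      (∀ a, 0 ≤ f a) → (∀ s, 0 ≤ sup s) → (∀ t, 0 ≤ dem t) → (∀ a, 0 < f a → a ∈ E) →
      (∀ v, D.net f v = massAt ps sup v - massAt pt dem v) →
      (Finset.univ.filter fun a => 0 < f a).card + (Finset.univ.filter fun s => 0 < sup s).card +
        (Finset.univ.filter fun t => 0 < dem t).card = n →
      ∃ m : S → T → ℝ, (∀ s t, 0 ≤ m s t) ∧ (∀ s, ∑ t, m s t = sup s) ∧
        (∀ t, ∑ s, m s t = dem t) ∧ (∀ s t, 0 < m s t → D.Reach E (ps s) (pt t)) ∧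
        ∀ a ∈ E, ∑ t, ∑ s, (if D.Reach E (ps s) (D.src a) ∧ D.Reach E (D.tgt a) (pt t)
          then m s t else 0) ≤ f a := by
  intro n
  induction n using Nat.strong_induction_on with
  | _ n ih =>
  intro f ps sup pt dem hf hsup hdem hfE hbal hn
  -- A source and a sink at the same vertex are matched as far as possible, which exhausts one of
  -- them. Since ranks increase along arcs, the matched pair passes through no arc.
  by_cases h1 : ∃ s t, 0 < sup s ∧ 0 < dem t ∧ ps s = pt t
  · obtain ⟨s₀, t₀, hs₀, ht₀, hst⟩ := h1
    set μ := min (sup s₀) (dem t₀) with hμ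
    have hμ0 : 0 < μ := lt_min hs₀ ht₀
    have hμs : μ ≤ sup s₀ := min_le_left _ _
    have hμt : μ ≤ dem t₀ := min_le_right _ _
    set sup' : S → ℝ := fun s => sup s - if s = s₀ then μ else 0 with hsup'
    set dem' : T → ℝ := fun t => dem t - if t = t₀ then μ else 0 with hdem'
    have hs' : ∀ s, 0 ≤ sup' s ∧ sup' s ≤ sup s := by
      intro s; simp only [hsup']; split_ifs with h
      · subst h; constructor <;> linarith
      · constructor <;> linarith [hsup s]
    have ht' : ∀ t, 0 ≤ dem' t ∧ dem' t ≤ dem t := by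
      intro t; simp only [hdem']; split_ifs with h
      · subst h; constructor <;> linarith
      · constructor <;> linarith [hdem t]
    have hlt : (Finset.univ.filter fun a => 0 < f a).card +
        (Finset.univ.filter fun s => 0 < sup' s).card +
        (Finset.univ.filter fun t => 0 < dem' t).card < n := by
      have e1 := card_filter_le_card_filter (P := fun s => 0 < sup' s) (Q := fun s => 0 < sup s)
        fun s h => lt_of_lt_of_le h (hs' s).2
      have e2 := card_filter_le_card_filter (P := fun s => 0 < dem' s) (Q := fun s => 0 < dem s)
        fun s h => lt_of_lt_of_le h (ht' s).2
      rcases min_choice (sup s₀) (dem t₀) with h | h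
      · have := card_filter_lt_card_filter (P := fun s => 0 < sup' s) (Q := fun s => 0 < sup s)
          (fun s h => lt_of_lt_of_le h (hs' s).2) ⟨s₀, hs₀, by simp [hsup', hμ, h]⟩
        omega
      · have := card_filter_lt_card_filter (P := fun s => 0 < dem' s) (Q := fun s => 0 < dem s)
          (fun s h => lt_of_lt_of_le h (ht' s).2) ⟨t₀, ht₀, by simp [hdem', hμ, h]⟩
        omega
    obtain ⟨m, hm0, hmr, hmc, hmR, hml⟩ := ih _ hlt f ps sup' pt dem' hf (fun s => (hs' s).1)
      (fun t => (ht' t).1) hfE (fun v => by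
        rw [hbal v]
        rw [hsup', hdem', massAt_sub_single, massAt_sub_single, hst]; ring) rfl
    refine ⟨fun s t => m s t + if s = s₀ ∧ t = t₀ then μ else 0, fun s t => ?_, fun s => ?_,
      fun t => ?_, fun s t h => ?_, fun a ha => ?_⟩
    · have := hm0 s t
      show 0 ≤ m s t + _
      split_ifs <;> linarith
    · rw [Finset.sum_add_distrib, hmr]
      by_cases h : s = s₀ <;> simp [h, hsup']
    · rw [Finset.sum_add_distrib, hmc]
      by_cases h : t = t₀ <;> simp [h, hdem']
    · by_cases h' : s = s₀ ∧ t = t₀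
      · rw [h'.1, h'.2, hst]; exact Reach.refl _ _
      · simp only [h', if_false, add_zero] at h; exact hmR s t h
    · refine le_trans (le_of_eq ?_) (hml a ha)
      refine Finset.sum_congr rfl fun t _ => Finset.sum_congr rfl fun s _ => ?_
      by_cases h : D.Reach E (ps s) (D.src a) ∧ D.Reach E (D.tgt a) (pt t)
      · rw [if_pos h, if_pos h]
        refine (congrArg (m s t + ·) (if_neg ?_)).trans (add_zero _)
        rintro ⟨rfl, rfl⟩
        have e1 := h.1.rank_le hρ
        have e2 := h.2.rank_le hρ
        have e3 := hρ a ha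
        rw [hst] at e1; omega
      · rw [if_neg h, if_neg h]
  · push Not at h1
    by_cases h2 : ∃ a, 0 < f a
    -- No flow enters the lowest tail `y`, and no other flow leaves it. A source with supply sits at
    -- `y`, hence no sink with demand does. So `f e` is exactly the supply at `y`, and its sources
    -- can be advanced along `e`.
    · obtain ⟨e, he, hemin⟩ := Finset.exists_min_image (Finset.univ.filter fun a => 0 < f a)
        (fun a => ρ (D.src a)) (by obtain ⟨a, ha⟩ := h2; exact ⟨a, by simpa using ha⟩)
      simp only [Finset.mem_filter, Finset.mem_univ, true_and] at he hemin
      have heE := hfE e he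
      set y := D.src e with hy
      have hnet : D.net f y = f e := by
        unfold net
        rw [Finset.sum_eq_single e]
        · have := hρ e heE
          rw [if_pos rfl, if_neg, sub_zero]
          intro h; rw [h] at this; exact lt_irrefl _ this
        · intro a _ hae
          have e1 : (if D.src a = y then f a else 0) = 0 := by
            split_ifs with h
            · by_contra hne
              have := lt_of_le_of_ne (hf a) (Ne.symm hne)
              exact hae (hE a (hfE a this) e heE h)
            · rfl
          have e2 : (if D.tgt a = y then f a else 0) = 0 := by
            split_ifs with h
            · by_contra hne
              have := lt_of_le_of_ne (hf a) (Ne.symm hne)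
              have h3 := hemin a this
              have h4 := hρ a (hfE a this)
              rw [h] at h4; omega
            · rfl
          rw [e1, e2, sub_zero]
        · simp
      have hb := hbal y
      rw [hnet] at hb
      have hmass : f e = massAt ps sup y := by
        have hd : massAt pt dem y = 0 := by
          obtain ⟨s₀, hs₀, hs₀'⟩ := exists_pos_of_massAt_pos (p := ps) (g := sup) (v := y)
            (by linarith [massAt_nonneg (p := pt) hdem y])
          refine massAt_eq_zero fun t ht => le_antisymm ?_ (hdem t)
          by_contra hlt
          exact h1 s₀ t hs₀' (not_le.1 hlt) (hs₀.trans ht.symm)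
        rw [hb, hd, sub_zero]
      set ps' : S → V := fun s => if ps s = y then D.tgt e else ps s with hps'
      set f' : A → ℝ := fun a => f a - if a = e then f e else 0 with hf'
      have hf'0 : ∀ a, 0 ≤ f' a ∧ f' a ≤ f a := by
        intro a; simp only [hf']; split_ifs with h
        · subst h; simp [hf a]
        · simp [hf a]
      have hlt : (Finset.univ.filter fun a => 0 < f' a).card +
          (Finset.univ.filter fun s => 0 < sup s).card +
          (Finset.univ.filter fun t => 0 < dem t).card < n := by
        have := card_filter_lt_card_filter (P := fun s => 0 < f' s) (Q := fun s => 0 < f s)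
          (fun s h => lt_of_lt_of_le h (hf'0 s).2) ⟨e, he, by simp [hf']⟩
        omega
      obtain ⟨m, hm0, hmr, hmc, hmR, hml⟩ := ih _ hlt f' ps' sup pt dem (fun a => (hf'0 a).1)
        hsup hdem (fun a h => hfE a (lt_of_lt_of_le h (hf'0 a).2)) (fun v => by
          rw [hf', net_sub, net_single, hbal v]
          have e1 : massAt ps' sup v = massAt ps sup v -
              massAt ps sup y * ((if y = v then 1 else 0) - if D.tgt e = v then 1 else 0) := by
            unfold massAt
            rw [Finset.sum_mul, ← Finset.sum_sub_distrib]
            refine Finset.sum_congr rfl fun s _ => ?_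
            simp only [hps']
            by_cases h : ps s = y
            · simp only [h, if_true]; split_ifs <;> ring
            · simp [h]
          rw [e1, ← hmass, ← hy]
          split_ifs <;> ring) rfl
      refine ⟨m, hm0, hmr, hmc, fun s t h => ?_, fun a ha => ?_⟩
      · have := hmR s t h
        simp only [hps'] at this
        split_ifs at this with h'
        · rw [h']; exact (reach_arc heE).trans this
        · exact this
      · by_cases hae : a = e
        · subst hae
          have h3 := hml a ha
          have h4 : f' a = 0 := by simp [hf']
          rw [h4] at h3
          -- After the removal of its flow, `a` has no load in the remaining problem; its load
          -- consists of the sources just advanced, whose supplies add up to `f a`.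
          have h5 : f a = ∑ t, ∑ s, if ps s = y then m s t else 0 := by
            rw [hmass, Finset.sum_comm, massAt]
            refine Finset.sum_congr rfl fun s _ => ?_
            split_ifs
            · exact (hmr s).symm
            · simp
          calc _ ≤ ∑ t, ∑ s, ((if D.Reach E (ps' s) (D.src a) ∧ D.Reach E (D.tgt a) (pt t)
                  then m s t else 0) + if ps s = y then m s t else 0) := by
                refine Finset.sum_le_sum fun t _ => Finset.sum_le_sum fun s _ => ?_
                by_cases h : ps s = y
                · simp only [h, if_true]
                  have := hm0 s t
                  split_ifs <;> linarith
                · simp [hps', h]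
            _ ≤ f a := by
                simp only [Finset.sum_add_distrib]
                linarith
        · have h4 : f' a = f a := by simp [hf', hae]
          rw [← h4]
          refine le_trans ?_ (hml a ha)
          refine Finset.sum_le_sum fun t _ => Finset.sum_le_sum fun s _ => ?_
          by_cases h : D.Reach E (ps s) (D.src a) ∧ D.Reach E (D.tgt a) (pt t)
          · have h' : D.Reach E (ps' s) (D.src a) := by
              simp only [hps']
              split_ifs with hs
              · rcases h.1.eq_or_head with h6 | ⟨a', ha', h6, h7⟩
                · exact absurd (hE a ha e heE (h6.symm.trans hs)) hae
                · have : a' = e := hE a' ha' e heE (h6.trans hs)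
                  rwa [this] at h7
              · exact h.1
            rw [if_pos h, if_pos ⟨h', h.2⟩]
          · rw [if_neg h]
            split_ifs
            · exact hm0 s t
            · exact le_rfl
    · push Not at h2
      have hf0 : ∀ a, f a = 0 := fun a => le_antisymm (h2 a) (hf a)
      have hnet : ∀ v, massAt ps sup v = massAt pt dem v := fun v => by
        have := hbal v
        have h0 : D.net f v = 0 := by simp [net, hf0]
        linarith
      have hs0 : ∀ s, sup s = 0 := fun s => by
        by_contra h
        have h3 := lt_of_le_of_ne (hsup s) (Ne.symm h)
        obtain ⟨t, ht, ht'⟩ := exists_pos_of_massAt_pos (p := pt) (g := dem) (v := ps s)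
          (by rw [← hnet]; exact lt_of_lt_of_le h3 (le_massAt hsup s))
        exact h1 s t h3 ht' ht.symm
      have ht0 : ∀ t, dem t = 0 := fun t => by
        by_contra h
        have h3 := lt_of_le_of_ne (hdem t) (Ne.symm h)
        obtain ⟨s, hs, hs'⟩ := exists_pos_of_massAt_pos (p := ps) (g := sup) (v := pt t)
          (by rw [hnet]; exact lt_of_lt_of_le h3 (le_massAt hdem t))
        exact h1 s t hs' h3 hs
      exact ⟨fun _ _ => 0, by simp, by simp [hs0], by simp [ht0], by simp, by simp [hf0]⟩

end Transport

/-! ### States of the rounding procedure; moving a sink backwards -/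

/-- A partially routed transshipment: the flow `flow` has still to be decomposed into
contributions of the sources `S`, currently located at `srcPos`, to the sinks `T`, currently
located at `snkPos`. The flow may have been increased on the arcs of `closed`, and `moved` is the
set of the sinks that have left their original position. -/
structure FlowState (V A S T : Type*) where
  flow : A → ℝ
  srcPos : S → V
  supply : S → ℝ
  snkPos : T → V
  demand : T → ℝ
  closed : Set A
  moved : Set T

section

variable {V A S T : Type*}

/-- At most one arc of `E` leaves `v`. -/
def Unbranched (D : ArcDigraph V A) (E : Set A) (v : V) : Prop :=
  ∀ a ∈ E, ∀ a' ∈ E, D.src a = v → D.src a' = v → a = a'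

/-- No arc of `E` leaves `v`. -/
def DeadEnd (D : ArcDigraph V A) (E : Set A) (v : V) : Prop := ∀ a ∈ E, D.src a ≠ v

/-- The arcs carrying a positive amount of flow. -/
def FlowState.alive (σ : FlowState V A S T) : Set A := {a | 0 < σ.flow a}

theorem Unbranched.mono {D : ArcDigraph V A} {E F : Set A} {v : V} (h : D.Unbranched F v)
    (hEF : E ⊆ F) : D.Unbranched E v :=
  fun a ha a' ha' => h a (hEF ha) a' (hEF ha')

theorem DeadEnd.mono {D : ArcDigraph V A} {E F : Set A} {v : V} (h : D.DeadEnd F v)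
    (hEF : E ⊆ F) : D.DeadEnd E v :=
  fun a ha => h a (hEF ha)

theorem DeadEnd.unbranched {D : ArcDigraph V A} {E : Set A} {v : V} (h : D.DeadEnd E v) :
    D.Unbranched E v :=
  fun a ha _ _ h1 _ => absurd h1 (h a ha)

theorem DeadEnd.eq_of_reach {D : ArcDigraph V A} {E : Set A} {v w : V} (h : D.DeadEnd E v)
    (hr : D.Reach E v w) : v = w := by
  rcases hr.eq_or_head with h1 | ⟨a, ha, h1, -⟩
  · exact h1
  · exact absurd h1 (h a ha)

/-- The invariants of the rounding procedure. -/
structure FlowState.Valid [Fintype A] [Fintype S] [Fintype T] [DecidableEq V]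
    (D : ArcDigraph V A) (ρ : V → ℕ) (σ : FlowState V A S T) : Prop where
  flow_nonneg : ∀ a, 0 ≤ σ.flow a
  supply_nonneg : ∀ s, 0 ≤ σ.supply s
  demand_nonneg : ∀ t, 0 ≤ σ.demand t
  balance : ∀ v, D.net σ.flow v = massAt σ.srcPos σ.supply v - massAt σ.snkPos σ.demand v
  rank : ∀ a ∈ σ.alive, ρ (D.src a) < ρ (D.tgt a)
  closed_unbranched : ∀ a ∈ σ.closed, a ∈ σ.alive → D.Unbranched σ.alive (D.tgt a)
  closed_succ : ∀ a ∈ σ.closed, a ∈ σ.alive → ∀ a' ∈ σ.alive, D.src a' = D.tgt a → a' ∈ σ.closed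
  -- The second alternative arises when a sink crosses a closed arc and uses up its flow: the tail
  -- of that arc becomes a dead end, and only the sink that has arrived may have too small a demand.
  closed_demand : ∀ a ∈ σ.closed, a ∈ σ.alive →
    (∀ t, 0 < σ.demand t → σ.snkPos t = D.tgt a → σ.flow a ≤ σ.demand t) ∨
    (D.DeadEnd σ.alive (D.tgt a) ∧
      ∃ t₀, ∀ t, t ≠ t₀ → 0 < σ.demand t → σ.snkPos t = D.tgt a → σ.flow a ≤ σ.demand t)
  unmoved_out : ∀ t ∉ σ.moved, ∀ a, D.src a ≠ σ.snkPos t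
  unmoved_alone : ∀ t ∉ σ.moved, ∀ t', 0 < σ.demand t' → σ.snkPos t' = σ.snkPos t → t' = t

open scoped Classical in
/-- The total amount that reaches `t` along paths through `e`. -/
noncomputable def arcLoad [Fintype S] (m : S → T → ℝ) (path : S → T → List A) (e : A) (t : T) :
    ℝ :=
  ∑ s, if e ∈ path s t then m s t else 0

/-- The arc `e` belongs to the layer assigned to the sink `t`. -/
def FlowState.Own (σ : FlowState V A S T) (lab : A → Bool) (lay : T → Bool) (e : A) (t : T) :
    Prop := t ∈ σ.moved ∨ lab e = lay t

open scoped Classical in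
/-- The amount that may still be routed along `e` in addition to one sink. -/
noncomputable def FlowState.cap (σ : FlowState V A S T) (e : A) : ℝ :=
  if e ∈ σ.closed then 0 else σ.flow e

open scoped Classical in
/-- A complete unsplittable routing of a partially routed transshipment; the sink `t` is
assigned to the layer `lay t` and receives the amount `q t` within this layer. -/
structure FlowState.IsRouting [Fintype S] [Fintype T] (D : ArcDigraph V A) (lab : A → Bool)
    (σ : FlowState V A S T) (m : S → T → ℝ) (path : S → T → List A) (lay : T → Bool)
    (q : T → ℝ) : Prop where
  nonneg : ∀ s t, 0 ≤ m s t
  row : ∀ s, ∑ t, m s t = σ.supply s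
  col : ∀ t, ∑ s, m s t = σ.demand t
  walk : ∀ s t, 0 < m s t → D.IsWalk (σ.srcPos s) (σ.snkPos t) (path s t)
  walk_alive : ∀ s t, 0 < m s t → ∀ a ∈ path s t, a ∈ σ.alive
  q_moved : ∀ t ∈ σ.moved, q t = σ.demand t
  load_le_q : ∀ t ∉ σ.moved, ∀ e, lab e = lay t → arcLoad m path e t ≤ q t
  load_le_sub : ∀ t ∉ σ.moved, ∀ e, lab e ≠ lay t → arcLoad m path e t ≤ σ.demand t - q t
  -- Since `σ.cap e` vanishes on closed arcs, increased flow values never enter this bound.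
  own : ∀ e β, 0 ≤ β →
    ∑ t, (if q t ≤ β ∧ σ.Own lab lay e t then arcLoad m path e t else 0) ≤ σ.cap e + β
  foreign : ∀ e t t', ¬ σ.Own lab lay e t → ¬ σ.Own lab lay e t' →
    0 < arcLoad m path e t → 0 < arcLoad m path e t' → t = t'

/-- The existence of a routing. -/
def FlowState.Routable [Fintype S] [Fintype T] (D : ArcDigraph V A) (lab : A → Bool)
    (σ : FlowState V A S T) : Prop :=
  ∃ m path lay q, σ.IsRouting D lab m path lay q

open scoped Classical in
/-- The measure that decreases during the rounding procedure. -/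
noncomputable def FlowState.size [Fintype A] [Fintype T] (ρ : V → ℕ) (σ : FlowState V A S T) : ℕ :=
  (Finset.univ.filter fun a => 0 < σ.flow a).card + ∑ t, ρ (σ.snkPos t)

theorem arcLoad_nonneg [Fintype S] {m : S → T → ℝ} (hm : ∀ s t, 0 ≤ m s t)
    (path : S → T → List A) (e : A) (t : T) : 0 ≤ arcLoad m path e t :=
  Finset.sum_nonneg fun s _ => by split_ifs; exacts [hm s t, le_rfl]

theorem arcLoad_le_sum [Fintype S] {m : S → T → ℝ} (hm : ∀ s t, 0 ≤ m s t)
    (path : S → T → List A) (e : A) (t : T) : arcLoad m path e t ≤ ∑ s, m s t :=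
  Finset.sum_le_sum fun s _ => by split_ifs; exacts [le_rfl, hm s t]

theorem arcLoad_eq_zero [Fintype S] {m : S → T → ℝ} (hm : ∀ s t, 0 ≤ m s t)
    {path : S → T → List A} {e : A} {t : T} (h : ∀ s, 0 < m s t → e ∉ path s t) :
    arcLoad m path e t = 0 :=
  Finset.sum_eq_zero fun s _ => by
    split_ifs with h'
    · by_contra hne
      exact h s (lt_of_le_of_ne (hm s t) (Ne.symm hne)) h'
    · rfl

theorem FlowState.IsRouting.arcLoad_eq_zero_of_dead [Fintype S] [Fintype T]
    {D : ArcDigraph V A} {lab : A → Bool}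
    {σ : FlowState V A S T} {m : S → T → ℝ} {path : S → T → List A} {lay : T → Bool}
    {q : T → ℝ} (h : σ.IsRouting D lab m path lay q) {e : A} (he : e ∉ σ.alive) (t : T) :
    arcLoad m path e t = 0 :=
  arcLoad_eq_zero h.nonneg fun s hs hmem => he (h.walk_alive s t hs e hmem)

variable [Fintype A] [Fintype S] [Fintype T] [DecidableEq V] {D : ArcDigraph V A}
  {ρ : V → ℕ} {lab : A → Bool} {σ : FlowState V A S T}

theorem FlowState.Valid.cap_nonneg (h : σ.Valid D ρ) (e : A) : 0 ≤ σ.cap e := by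
  unfold cap; split_ifs; exacts [le_rfl, h.flow_nonneg e]

/-- Without flow, supply and demand agree at every vertex, so empty paths serve everything. -/
theorem FlowState.Valid.routable_of_flow_eq_zero (h : σ.Valid D ρ) (h0 : ∀ a, σ.flow a = 0) :
    σ.Routable D lab := by
  classical
  obtain ⟨m, hm0, hmr, hmc, hmR, -⟩ := exists_transport (D := D) (E := ∅) (ρ := ρ)
    (by simp) (by simp) _ (fun _ => 0) σ.srcPos σ.supply σ.snkPos σ.demand (by simp)
    h.supply_nonneg h.demand_nonneg (by simp) (fun v => by
      rw [← h.balance v]; simp [net, h0]) rfl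
  have hl : ∀ e t, arcLoad m (fun _ _ => ([] : List A)) e t = 0 := by simp [arcLoad]
  refine ⟨m, fun _ _ => [], fun _ => true, σ.demand, hm0, hmr, hmc, fun s t hst => ?_,
    by simp, by simp, fun t _ e _ => by rw [hl]; exact h.demand_nonneg t,
    fun t _ e _ => by rw [hl]; simp, fun e β hβ => ?_, fun e t t' _ _ h1 => ?_⟩
  · rcases (hmR s t hst).eq_or_head with h1 | ⟨a, ha, -⟩
    · exact h1
    · simp at ha
  · simp only [hl, ite_self, Finset.sum_const_zero]
    linarith [h.cap_nonneg e]
  · rw [hl] at h1; exact absurd h1 (lt_irrefl _)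

open scoped Classical in
/-- Move the sink `t₀` backwards along the arc `e`. -/
noncomputable def FlowState.moveSink (D : ArcDigraph V A) (σ : FlowState V A S T) (t₀ : T)
    (e : A) : FlowState V A S T where
  flow a := σ.flow a - if a = e then σ.demand t₀ else 0
  srcPos := σ.srcPos
  supply := σ.supply
  snkPos := Function.update σ.snkPos t₀ (D.src e)
  demand := σ.demand
  closed := σ.closed
  moved := insert t₀ σ.moved

variable {t₀ : T} {e : A}

theorem FlowState.moveSink_flow_nonneg (h : σ.Valid D ρ) (hle : σ.demand t₀ ≤ σ.flow e) (a : A) :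
    0 ≤ (σ.moveSink D t₀ e).flow a ∧ (σ.moveSink D t₀ e).flow a ≤ σ.flow a := by
  simp only [moveSink]
  split_ifs with h1
  · subst h1; constructor <;> linarith [h.demand_nonneg t₀]
  · simp [h.flow_nonneg a]

/-- The delicate invariant is `closed_demand` for a closed arc `a` ending at the new position of
`t₀`. Then `e` is closed as well, so `hcl` makes its flow vanish. As the head of `a` is unbranched,
it becomes a dead end, and `t₀` is allowed as the exceptional sink. -/
theorem FlowState.Valid.moveSink (h : σ.Valid D ρ) (ht₀ : 0 < σ.demand t₀)
    (hpos : σ.snkPos t₀ = D.tgt e) (hle : σ.demand t₀ ≤ σ.flow e)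
    (hcl : e ∈ σ.closed → σ.flow e = σ.demand t₀) : (σ.moveSink D t₀ e).Valid D ρ := by
  classical
  have hf := σ.moveSink_flow_nonneg h hle
  have hal : (σ.moveSink D t₀ e).alive ⊆ σ.alive := fun a ha => lt_of_lt_of_le ha (hf a).2
  have he : e ∈ σ.alive := lt_of_lt_of_le ht₀ hle
  have hpos' : ∀ t, t ≠ t₀ → (σ.moveSink D t₀ e).snkPos t = σ.snkPos t := fun t ht => by
    simp [FlowState.moveSink, ht]
  have hpos₀ : (σ.moveSink D t₀ e).snkPos t₀ = D.src e := by simp [FlowState.moveSink]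
  refine ⟨fun a => (hf a).1, h.supply_nonneg, h.demand_nonneg, fun v => ?_,
    fun a ha => h.rank a (hal ha), fun a hc ha => (h.closed_unbranched a hc (hal ha)).mono hal,
    fun a hc ha a' ha' => h.closed_succ a hc (hal ha) a' (hal ha'), fun a hc ha => ?_,
    fun t ht a => ?_, fun t ht t' hd hp => ?_⟩
  · simp only [FlowState.moveSink]
    rw [net_sub, net_single, massAt_update, h.balance v, hpos]; ring
  · by_cases hae : D.tgt a = D.src e
    · have hec : e ∈ σ.closed := h.closed_succ a hc (hal ha) e he hae.symm
      have hfe : e ∉ (σ.moveSink D t₀ e).alive := by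
        simp [FlowState.alive, FlowState.moveSink, hcl hec]
      refine Or.inr ⟨fun a' ha' hs => hfe ?_, t₀, fun t ht hd hp => (hf a).2.trans ?_⟩
      · have := h.closed_unbranched a hc (hal ha) a' (hal ha') e he hs hae.symm
        exact this ▸ ha'
      · rw [hpos' t ht] at hp
        rcases h.closed_demand a hc (hal ha) with h1 | ⟨h1, -⟩
        · exact h1 t hd hp
        · exact absurd hae.symm (h1 e he)
    · have hne : ∀ t, (σ.moveSink D t₀ e).snkPos t = D.tgt a → t ≠ t₀ := by
        rintro t ht rfl; exact hae (ht.symm.trans hpos₀)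
      rcases h.closed_demand a hc (hal ha) with h1 | ⟨h1, t₁, h2⟩
      · refine Or.inl fun t hd hp => (hf a).2.trans (h1 t hd ?_)
        rw [← hpos' t (hne t hp)]; exact hp
      · refine Or.inr ⟨h1.mono hal, t₁, fun t ht hd hp => (hf a).2.trans (h2 t ht hd ?_)⟩
        rw [← hpos' t (hne t hp)]; exact hp
  · simp only [FlowState.moveSink, Set.mem_insert_iff, not_or] at ht
    rw [hpos' t ht.1]; exact h.unmoved_out t ht.2 a
  · simp only [FlowState.moveSink, Set.mem_insert_iff, not_or] at ht
    rw [hpos' t ht.1] at hp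
    by_cases h1 : t' = t₀
    · rw [h1, hpos₀] at hp; exact absurd hp (h.unmoved_out t ht.2 e)
    · rw [hpos' t' h1] at hp; exact h.unmoved_alone t ht.2 t' hd hp

theorem FlowState.size_moveSink_lt (h : σ.Valid D ρ) (ht₀ : 0 < σ.demand t₀)
    (hpos : σ.snkPos t₀ = D.tgt e) (hle : σ.demand t₀ ≤ σ.flow e) :
    (σ.moveSink D t₀ e).size ρ < σ.size ρ := by
  classical
  have hf := σ.moveSink_flow_nonneg h hle
  have h1 := card_filter_le_card_filter (P := fun a => 0 < (σ.moveSink D t₀ e).flow a)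
    (Q := fun a => 0 < σ.flow a) fun a ha => lt_of_lt_of_le ha (hf a).2
  have h2 : ρ (D.src e) < ρ (D.tgt e) := h.rank e (lt_of_lt_of_le ht₀ hle)
  have h3 : ∑ t, ρ ((σ.moveSink D t₀ e).snkPos t) < ∑ t, ρ (σ.snkPos t) := by
    refine Finset.sum_lt_sum (fun t _ => ?_) ⟨t₀, Finset.mem_univ _, ?_⟩
    · by_cases ht : t = t₀
      · subst ht; simp only [FlowState.moveSink, Function.update_self, hpos]; exact h2.le
      · simp [FlowState.moveSink, ht]
    · simp only [FlowState.moveSink, Function.update_self, hpos]; exact h2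
  unfold size
  omega

/-- The walks to `t₀` are prolonged by `e`, and `t₀` is assigned the layer of `e`; all its walks lie
in this layer because they lead to the tail of `e`. If `e` is not closed, the drop of its flow pays
for the new load. If `e` is closed, it is dead after the move, so `t₀` is its only user. -/
theorem FlowState.routable_of_moveSink (hlab : ∀ a a', D.tgt a = D.src a' → lab a = lab a')
    (h : σ.Valid D ρ) (ht₀ : 0 < σ.demand t₀)
    (hpos : σ.snkPos t₀ = D.tgt e) (hle : σ.demand t₀ ≤ σ.flow e)
    (hcl : e ∈ σ.closed → σ.flow e = σ.demand t₀)
    (hr : (σ.moveSink D t₀ e).Routable D lab) : σ.Routable D lab := by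
  classical
  have hf := σ.moveSink_flow_nonneg h hle
  obtain ⟨m, path, lay, q, hr⟩ := hr
  have hcol : ∀ t, ∑ s, m s t = σ.demand t := hr.col
  have hq₀ : q t₀ = σ.demand t₀ := hr.q_moved t₀ (Set.mem_insert _ _)
  set path' : S → T → List A := fun s t => if t = t₀ then path s t ++ [e] else path s t with hpath'
  set lay' : T → Bool := Function.update lay t₀ (lab e) with hlay'
  have hpos₀ : (σ.moveSink D t₀ e).snkPos t₀ = D.src e := by simp [FlowState.moveSink]
  have hload : ∀ e' t, t ≠ t₀ → arcLoad m path' e' t = arcLoad m path e' t := by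
    intro e' t ht; simp [arcLoad, hpath', ht]
  have hload₀ : ∀ e', e' ≠ e → arcLoad m path' e' t₀ = arcLoad m path e' t₀ := by
    intro e' he'; simp [arcLoad, hpath', he']
  have hload1 : ∀ e' t, arcLoad m path' e' t ≤
      arcLoad m path e' t + if t = t₀ ∧ e' = e then σ.demand t₀ else 0 := by
    intro e' t
    by_cases ht : t = t₀
    · subst ht
      by_cases he' : e' = e
      · simp only [he', and_self, if_true]
        have := arcLoad_le_sum hr.nonneg path' e t
        rw [hcol] at this
        linarith [arcLoad_nonneg hr.nonneg path e t]
      · simp [he', hload₀ e' he']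
    · simp [ht, hload e' t ht]
  have hzero : ∀ e', lab e' ≠ lab e → arcLoad m path' e' t₀ = 0 := by
    intro e' he'
    refine arcLoad_eq_zero hr.nonneg fun s hs hmem => ?_
    simp only [hpath', if_true, List.mem_append, List.mem_singleton] at hmem
    rcases hmem with hmem | rfl
    · exact he' ((hr.walk s t₀ hs).label_eq hlab hpos₀.symm e' hmem)
    · exact he' rfl
  have hown : ∀ e' t, σ.Own lab lay' e' t → (σ.moveSink D t₀ e).Own lab lay e' t := by
    intro e' t ho
    by_cases ht : t = t₀
    · exact Or.inl (ht ▸ Set.mem_insert _ _)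
    · rcases ho with ho | ho
      · exact Or.inl (Set.mem_insert_of_mem _ ho)
      · right; simpa [hlay', ht] using ho
  have hown' : ∀ e' t, t ≠ t₀ → ¬ σ.Own lab lay' e' t →
      ¬ (σ.moveSink D t₀ e).Own lab lay e' t := by
    intro e' t ht ho hn
    rcases hn with hn | hn
    · rcases Set.mem_insert_iff.1 hn with h1 | h1
      · exact ht h1
      · exact ho (Or.inl h1)
    · exact ho (Or.inr (by simpa [hlay', ht] using hn))
  refine ⟨m, path', lay', q, hr.nonneg, hr.row, hr.col, fun s t hst => ?_, fun s t hst a ha => ?_,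
    fun t ht => hr.q_moved t (Set.mem_insert_of_mem _ ht), fun t ht e' he' => ?_,
    fun t ht e' he' => ?_, fun e' β hβ => ?_, fun e' t t' h1 h2 h3 h4 => ?_⟩
  · by_cases ht : t = t₀
    · subst ht
      simp only [hpath', if_true, hpos]
      have := hr.walk s t hst
      rw [hpos₀] at this
      exact this.append (isWalk_singleton e)
    · have := hr.walk s t hst
      simpa [hpath', ht, FlowState.moveSink] using this
  · have key : ∀ a ∈ path s t, a ∈ σ.alive := fun a ha =>
      lt_of_lt_of_le (hr.walk_alive s t hst a ha) (hf a).2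
    by_cases ht : t = t₀
    · simp only [hpath', ht, if_true, List.mem_append, List.mem_singleton] at ha
      rcases ha with ha | rfl
      · exact key a (ht ▸ ha)
      · exact lt_of_lt_of_le ht₀ hle
    · simp only [hpath', ht, if_false] at ha; exact key a ha
  · by_cases htt : t = t₀
    · rw [htt, hq₀, ← hcol]; exact arcLoad_le_sum hr.nonneg _ _ _
    · rw [hload _ _ htt]
      refine hr.load_le_q t ?_ e' (by simpa [hlay', htt] using he')
      simp [FlowState.moveSink, htt, ht]
  · by_cases htt : t = t₀
    · subst htt
      rw [hzero e' (by simpa [hlay'] using he'), hq₀]; simp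
    · rw [hload _ _ htt]
      refine hr.load_le_sub t ?_ e' (by simpa [hlay', htt] using he')
      simp [FlowState.moveSink, htt, ht]
  · have h1 := hr.own e' β hβ
    have h2 : ∑ t, (if q t ≤ β ∧ σ.Own lab lay' e' t then arcLoad m path' e' t else 0) ≤
        (∑ t, if q t ≤ β ∧ (σ.moveSink D t₀ e).Own lab lay e' t then arcLoad m path e' t else 0)
        + if e' = e ∧ σ.demand t₀ ≤ β then σ.demand t₀ else 0 := by
      have h3 : (if e' = e ∧ σ.demand t₀ ≤ β then σ.demand t₀ else 0) =
          ∑ t, if t = t₀ then (if e' = e ∧ σ.demand t₀ ≤ β then σ.demand t₀ else 0) else 0 := by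
        simp
      rw [h3, ← Finset.sum_add_distrib]
      refine Finset.sum_le_sum fun t _ => ?_
      have h4 := hload1 e' t
      have h5 := arcLoad_nonneg hr.nonneg path e' t
      by_cases h6 : q t ≤ β ∧ σ.Own lab lay' e' t
      · rw [if_pos h6, if_pos ⟨h6.1, hown e' t h6.2⟩]
        by_cases ht : t = t₀
        · subst ht
          have := h6.1
          rw [hq₀] at this
          simpa [this] using h4
        · simpa [ht] using h4
      · rw [if_neg h6]
        have := h.demand_nonneg t₀
        split_ifs <;> linarith
    by_cases he' : e' = e
    · subst he'
      by_cases hec : e' ∈ σ.closed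
      · have h3 : ∀ t, arcLoad m path e' t = 0 := fun t =>
          hr.arcLoad_eq_zero_of_dead (by simp [FlowState.alive, FlowState.moveSink, hcl hec]) t
        simp only [h3, ite_self, Finset.sum_const_zero, zero_add, true_and] at h2
        have := h.cap_nonneg e'
        split_ifs at h2 <;> linarith
      · have h3 : (σ.moveSink D t₀ e').cap e' = σ.cap e' - σ.demand t₀ := by
          simp [FlowState.cap, FlowState.moveSink, hec]
        rw [h3] at h1
        have := h.demand_nonneg t₀
        split_ifs at h2 <;> linarith
    · have h3 : (σ.moveSink D t₀ e).cap e' = σ.cap e' := by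
        simp [FlowState.cap, FlowState.moveSink, he']
      rw [h3] at h1
      simp only [he', false_and, if_false, add_zero] at h2
      linarith
  · by_cases ht : t = t₀
    · subst ht
      rw [hzero e' fun hh => h1 (Or.inr (by simpa [hlay'] using hh))] at h3
      exact absurd h3 (lt_irrefl _)
    · by_cases ht' : t' = t₀
      · subst ht'
        rw [hzero e' fun hh => h2 (Or.inr (by simpa [hlay'] using hh))] at h4
        exact absurd h4 (lt_irrefl _)
      · rw [hload _ _ ht] at h3
        rw [hload _ _ ht'] at h4
        exact hr.foreign e' t t' (hown' _ _ ht h1) (hown' _ _ ht' h2) h3 h4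

end

/-! ### Contracting a tree with at most one entering arc -/

section Tree

set_option linter.unusedSectionVars false

variable {V A S T : Type*} [Fintype A] [Fintype S] [Fintype T] [DecidableEq V]
  {D : ArcDigraph V A} {ρ : V → ℕ} {lab : A → Bool} {σ : FlowState V A S T} {X : Set V} {q : A}

/-- `X` spans a tree whose arcs lead towards its only dead end, and `q` is an arc of the tree or
the only arc entering it. -/
structure FlowState.IsTree (D : ArcDigraph V A) (σ : FlowState V A S T) (X : Set V) (q : A) :
    Prop where
  out : ∀ a ∈ σ.alive, D.src a ∈ X → D.tgt a ∈ X
  unbranched : ∀ v ∈ X, D.Unbranched σ.alive v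
  into : ∀ a ∈ σ.alive, D.tgt a ∈ X → D.src a ∉ X → a = q
  alive : q ∈ σ.alive
  tgt_mem : D.tgt q ∈ X
  src_branched : D.src q ∉ X → ¬ D.Unbranched σ.alive (D.src q)
  end_unique : ∀ v ∈ X, ∀ v' ∈ X, D.DeadEnd σ.alive v → D.DeadEnd σ.alive v' → v = v'

/-- The arcs with positive flow within the tree. -/
def FlowState.treeArcs (D : ArcDigraph V A) (σ : FlowState V A S T) (X : Set V) : Set A :=
  {a | a ∈ σ.alive ∧ D.src a ∈ X}

open scoped Classical in
/-- The amount of flow entering the tree. -/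
noncomputable def FlowState.inflow (D : ArcDigraph V A) (σ : FlowState V A S T) (X : Set V)
    (q : A) : ℝ := if D.src q ∈ X then 0 else σ.flow q

/-- The positions of the sources of the tree, the inflow being a source as well. -/
def FlowState.treePos (D : ArcDigraph V A) (σ : FlowState V A S T) (q : A) : Option S → V
  | none => D.tgt q
  | some s => σ.srcPos s

open scoped Classical in
/-- A transport plan within the tree. -/
structure FlowState.IsPlan (D : ArcDigraph V A) (σ : FlowState V A S T) (X : Set V) (q : A)
    (m₀ : Option S → T → ℝ) : Prop where
  nonneg : ∀ o t, 0 ≤ m₀ o t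
  row_none : ∑ t, m₀ none t = σ.inflow D X q
  row_some : ∀ s, ∑ t, m₀ (some s) t = if σ.srcPos s ∈ X then σ.supply s else 0
  col : ∀ t, ∑ o, m₀ o t = if σ.snkPos t ∈ X then σ.demand t else 0
  reach : ∀ o t, 0 < m₀ o t → D.Reach (σ.treeArcs D X) (σ.treePos D q o) (σ.snkPos t)
  load : ∀ a ∈ σ.treeArcs D X, ∑ t, ∑ o, (if D.Reach (σ.treeArcs D X) (σ.treePos D q o) (D.src a)
    ∧ D.Reach (σ.treeArcs D X) (D.tgt a) (σ.snkPos t) then m₀ o t else 0) ≤ σ.flow a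

theorem FlowState.inflow_nonneg (hv : σ.Valid D ρ) : 0 ≤ σ.inflow D X q := by
  unfold inflow; split_ifs; exacts [le_rfl, hv.flow_nonneg q]

/-- This is `exists_transport` for the flow on arcs with tail in `X`. Flow entering from outside is
modelled as one more source at the head of `q`, which makes up for the flow of `q` that is left out.
-/
theorem FlowState.IsTree.exists_plan (h : σ.IsTree D X q) (hv : σ.Valid D ρ) :
    ∃ m₀, σ.IsPlan D X q m₀ := by
  classical
  have hdead : ∀ a, a ∉ σ.alive → σ.flow a = 0 := fun a ha =>
    le_antisymm (not_lt.1 ha) (hv.flow_nonneg a)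
  set supO : Option S → ℝ := fun o => o.elim (σ.inflow D X q)
    (fun s => if σ.srcPos s ∈ X then σ.supply s else 0) with hsupO
  set dem : T → ℝ := fun t => if σ.snkPos t ∈ X then σ.demand t else 0 with hdem
  set fE : A → ℝ := fun a => if D.src a ∈ X then σ.flow a else 0 with hfE
  obtain ⟨m, h0, h1, h2, h3, h4⟩ := exists_transport (D := D) (E := σ.treeArcs D X) (ρ := ρ)
    (fun a ha a' ha' hs => h.unbranched _ ha.2 a ha.1 a' ha'.1 rfl hs.symm)
    (fun a ha => hv.rank a ha.1) _ fE (σ.treePos D q) supO σ.snkPos dem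
    (fun a => by simp only [hfE]; split_ifs; exacts [hv.flow_nonneg a, le_rfl])
    (fun o => by
      cases o with
      | none => exact inflow_nonneg hv
      | some s => simp only [hsupO, Option.elim]; split_ifs; exacts [hv.supply_nonneg s, le_rfl])
    (fun t => by simp only [hdem]; split_ifs; exacts [hv.demand_nonneg t, le_rfl])
    (fun a ha => by
      simp only [hfE] at ha
      split_ifs at ha with h5
      · exact ⟨ha, h5⟩
      · exact absurd ha (lt_irrefl _))
    (fun v => by
      have e1 : massAt (σ.treePos D q) supO v = (if D.tgt q = v then σ.inflow D X q else 0) +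
          massAt σ.srcPos (fun s => if σ.srcPos s ∈ X then σ.supply s else 0) v := by
        simp [massAt, Fintype.sum_option, FlowState.treePos, hsupO]
      rw [e1]
      by_cases hvX : v ∈ X
      · have e2 : massAt σ.srcPos (fun s => if σ.srcPos s ∈ X then σ.supply s else 0) v =
            massAt σ.srcPos σ.supply v :=
          Finset.sum_congr rfl fun s _ => by
            by_cases hs : σ.srcPos s = v
            · simp [hs, hvX]
            · simp [hs]
        have e3 : massAt σ.snkPos dem v = massAt σ.snkPos σ.demand v :=
          Finset.sum_congr rfl fun s _ => by
            by_cases hs : σ.snkPos s = v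
            · simp [hdem, hs, hvX]
            · simp [hs]
        have e4 : D.net fE v = D.net σ.flow v + if D.tgt q = v then σ.inflow D X q else 0 := by
          have : (if D.tgt q = v then σ.inflow D X q else 0) =
              ∑ a, if a = q then (if D.tgt a = v then σ.inflow D X q else 0) else 0 := by simp
          rw [this, net, net, ← Finset.sum_add_distrib]
          refine Finset.sum_congr rfl fun a _ => ?_
          have e5 : (if D.src a = v then fE a else 0) = if D.src a = v then σ.flow a else 0 := by
            by_cases hs : D.src a = v
            · simp [hfE, hs, hvX]
            · simp [hs]
          rw [e5]
          by_cases ht : D.tgt a = v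
          · simp only [ht, if_true]
            by_cases hs : D.src a ∈ X
            · simp only [hfE, hs, if_true]
              by_cases haq : a = q
              · subst haq; simp [FlowState.inflow, hs]
              · simp [haq]
            · simp only [hfE, hs, if_false]
              by_cases haq : a = q
              · subst haq; simp [FlowState.inflow, hs]
              · rw [hdead a fun ha => haq (h.into a ha (ht ▸ hvX) hs)]
                simp [haq]
          · simp [ht]
        rw [e2, e3, e4, hv.balance v]; ring
      · have e2 : massAt σ.srcPos (fun s => if σ.srcPos s ∈ X then σ.supply s else 0) v = 0 :=
          massAt_eq_zero fun s hs => by simp [hs, hvX]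
        have e3 : massAt σ.snkPos dem v = 0 :=
          massAt_eq_zero fun s hs => by simp [hdem, hs, hvX]
        have e4 : D.net fE v = 0 := by
          refine Finset.sum_eq_zero fun a _ => ?_
          have e5 : (if D.src a = v then fE a else 0) = 0 := by
            by_cases hs : D.src a = v
            · simp [hfE, hs, hvX]
            · simp [hs]
          have e6 : (if D.tgt a = v then fE a else 0) = 0 := by
            by_cases ht : D.tgt a = v
            · simp only [ht, if_true, hfE]
              split_ifs with hs
              · exact hdead a fun ha => hvX (ht ▸ h.out a ha hs)
              · rfl
            · simp [ht]
          rw [e5, e6, sub_zero]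
        have e5 : D.tgt q ≠ v := fun hh => hvX (hh ▸ h.tgt_mem)
        rw [e2, e3, e4, if_neg e5]; ring) rfl
  refine ⟨m, h0, h1 none, fun s => h1 (some s), h2, h3, fun a ha => ?_⟩
  have := h4 a ha
  simpa [hfE, ha.2] using this

variable {m₀ : Option S → T → ℝ}

theorem FlowState.IsPlan.eq_zero_of_snk (hp : σ.IsPlan D X q m₀) {t : T} (ht : σ.snkPos t ∉ X)
    (o : Option S) : m₀ o t = 0 := by
  have h1 := hp.col t
  rw [if_neg ht] at h1
  exact (Finset.sum_eq_zero_iff_of_nonneg fun o _ => hp.nonneg o t).1 h1 o (Finset.mem_univ _)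

theorem FlowState.IsPlan.eq_zero_of_src (hp : σ.IsPlan D X q m₀) {s : S} (hs : σ.srcPos s ∉ X)
    (t : T) : m₀ (some s) t = 0 := by
  have h1 := hp.row_some s
  rw [if_neg hs] at h1
  exact (Finset.sum_eq_zero_iff_of_nonneg fun t _ => hp.nonneg _ t).1 h1 t (Finset.mem_univ _)

theorem FlowState.IsPlan.src_notMem (hp : σ.IsPlan D X q m₀) {t : T} (ht : 0 < m₀ none t) :
    D.src q ∉ X := by
  intro h
  have h1 := hp.row_none
  simp only [inflow, h, if_true] at h1
  exact ht.ne' ((Finset.sum_eq_zero_iff_of_nonneg fun t _ => hp.nonneg _ t).1 h1 t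
    (Finset.mem_univ _))

theorem FlowState.IsPlan.snk_mem (hp : σ.IsPlan D X q m₀) {o : Option S} {t : T}
    (ht : 0 < m₀ o t) : σ.snkPos t ∈ X := by
  by_contra h
  exact ht.ne' (hp.eq_zero_of_snk h o)

theorem FlowState.IsPlan.demand_eq (hp : σ.IsPlan D X q m₀) {t : T} (ht : σ.snkPos t ∈ X) :
    m₀ none t + ∑ s, m₀ (some s) t = σ.demand t := by
  have h1 := hp.col t
  rwa [if_pos ht, Fintype.sum_option] at h1

open scoped Classical in
/-- Carry out the transport plan within the tree, the remaining demands being moved to the tail of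
the arc entering the tree. -/
noncomputable def FlowState.contract (D : ArcDigraph V A) (σ : FlowState V A S T) (X : Set V)
    (q : A) (r : T → ℝ) : FlowState V A S T where
  flow a := if D.tgt a ∈ X then 0 else σ.flow a
  srcPos := σ.srcPos
  supply s := if σ.srcPos s ∈ X then 0 else σ.supply s
  snkPos t := if 0 < r t then D.src q else σ.snkPos t
  demand t := if σ.snkPos t ∈ X then r t else σ.demand t
  closed := σ.closed
  moved := {t | t ∈ σ.moved ∨ σ.snkPos t ∈ X}

theorem FlowState.contract_alive {r : T → ℝ} {a : A} :
    a ∈ (σ.contract D X q r).alive ↔ a ∈ σ.alive ∧ D.tgt a ∉ X := by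
  simp only [alive, contract, Set.mem_ofPred_eq]
  split_ifs with h <;> simp [h]

/-- The residual demands add up to the inflow, so the balance at the tail of `q` is kept. If a sink
arrives there, this tail is branched, hence not the head of an alive closed arc, and `closed_demand`
is not affected. -/
theorem FlowState.IsTree.contract_valid (h : σ.IsTree D X q) (hv : σ.Valid D ρ)
    (hp : σ.IsPlan D X q m₀) : (σ.contract D X q (m₀ none)).Valid D ρ := by
  classical
  have hdead : ∀ a, a ∉ σ.alive → σ.flow a = 0 := fun a ha =>
    le_antisymm (not_lt.1 ha) (hv.flow_nonneg a)
  have hr0 : ∀ t, ¬ 0 < m₀ none t → m₀ none t = 0 := fun t ht =>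
    le_antisymm (not_lt.1 ht) (hp.nonneg _ t)
  have hal : (σ.contract D X q (m₀ none)).alive ⊆ σ.alive := fun a ha =>
    (contract_alive.1 ha).1
  refine ⟨fun a => ?_, fun s => ?_, fun t => ?_, fun v => ?_, fun a ha => hv.rank a (hal ha),
    fun a hc ha => (hv.closed_unbranched a hc (hal ha)).mono hal,
    fun a hc ha a' ha' => hv.closed_succ a hc (hal ha) a' (hal ha'), fun a hc ha => ?_,
    fun t ht a => ?_, fun t ht t' hd hpos => ?_⟩
  · simp only [FlowState.contract]; split_ifs; exacts [le_rfl, hv.flow_nonneg a]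
  · simp only [FlowState.contract]; split_ifs; exacts [le_rfl, hv.supply_nonneg s]
  · simp only [FlowState.contract]; split_ifs; exacts [hp.nonneg _ t, hv.demand_nonneg t]
  · by_cases hvX : v ∈ X
    · have e1 : D.net (σ.contract D X q (m₀ none)).flow v = 0 := by
        refine Finset.sum_eq_zero fun a _ => ?_
        have e2 : (if D.src a = v then (σ.contract D X q (m₀ none)).flow a else 0) = 0 := by
          by_cases hs : D.src a = v
          · simp only [FlowState.contract, hs, if_true]
            split_ifs with ht
            · rfl
            · exact hdead a fun ha => ht (h.out a ha (hs ▸ hvX))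
          · simp [hs]
        have e3 : (if D.tgt a = v then (σ.contract D X q (m₀ none)).flow a else 0) = 0 := by
          by_cases hs : D.tgt a = v
          · simp [FlowState.contract, hs, hvX]
          · simp [hs]
        rw [e2, e3, sub_zero]
      rw [e1, massAt_eq_zero fun s hs => ?_, massAt_eq_zero fun t ht => ?_, sub_zero]
      · simp only [FlowState.contract] at ht ⊢
        split_ifs at ht with h1
        · exact absurd (ht ▸ hvX) (hp.src_notMem h1)
        · simp [ht, hvX, hr0 t h1]
      · simp only [FlowState.contract] at hs ⊢
        simp [hs, hvX]
    · have e1 : D.net (σ.contract D X q (m₀ none)).flow v =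
          D.net σ.flow v - if D.src q = v then σ.inflow D X q else 0 := by
        have : (if D.src q = v then σ.inflow D X q else 0) =
            ∑ a, if a = q then (if D.src a = v then σ.inflow D X q else 0) else 0 := by simp
        rw [this, net, net, ← Finset.sum_sub_distrib]
        refine Finset.sum_congr rfl fun a _ => ?_
        have e3 : (if D.tgt a = v then (σ.contract D X q (m₀ none)).flow a else 0) =
            if D.tgt a = v then σ.flow a else 0 := by
          by_cases hs : D.tgt a = v
          · simp [FlowState.contract, hs, hvX]
          · simp [hs]
        rw [e3]
        by_cases hs : D.src a = v
        · have hs' : D.src a ∉ X := hs ▸ hvX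
          simp only [FlowState.contract, hs, if_true]
          by_cases haq : a = q
          · subst haq; simp [FlowState.inflow, hs', h.tgt_mem]
          · simp only [haq, if_false]
            by_cases ht : D.tgt a ∈ X
            · rw [hdead a fun ha => haq (h.into a ha ht hs')]; simp
            · simp [ht]
        · simp [hs]
      have e2 : massAt (σ.contract D X q (m₀ none)).srcPos
          (σ.contract D X q (m₀ none)).supply v = massAt σ.srcPos σ.supply v :=
        Finset.sum_congr rfl fun s _ => by
          by_cases hs : σ.srcPos s = v
          · simp [FlowState.contract, hs, hvX]
          · simp [FlowState.contract, hs]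
      have e3 : massAt (σ.contract D X q (m₀ none)).snkPos
          (σ.contract D X q (m₀ none)).demand v = massAt σ.snkPos σ.demand v +
          if D.src q = v then σ.inflow D X q else 0 := by
        have : (if D.src q = v then σ.inflow D X q else 0) =
            ∑ t, if D.src q = v then m₀ none t else 0 := by
          rw [← hp.row_none]; split_ifs <;> simp
        rw [this, massAt, massAt, ← Finset.sum_add_distrib]
        refine Finset.sum_congr rfl fun t _ => ?_
        simp only [FlowState.contract]
        by_cases h1 : 0 < m₀ none t
        · have h2 := hp.snk_mem h1
          have h3 : σ.snkPos t ≠ v := fun hh => hvX (hh ▸ h2)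
          simp [h1, h2, h3]
        · simp only [hr0 t h1, ite_self, add_zero]
          by_cases h3 : σ.snkPos t = v
          · simp [h3, hvX]
          · simp [h3]
      rw [e1, e2, e3, hv.balance v]; ring
  · obtain ⟨ha, haX⟩ := contract_alive.1 ha
    have key : ∀ t, 0 < (σ.contract D X q (m₀ none)).demand t →
        (σ.contract D X q (m₀ none)).snkPos t = D.tgt a →
        0 < σ.demand t ∧ σ.snkPos t = D.tgt a ∧
          (σ.contract D X q (m₀ none)).demand t = σ.demand t := by
      intro t hd ht
      simp only [FlowState.contract] at hd ht ⊢
      by_cases h1 : 0 < m₀ none t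
      · rw [if_pos h1] at ht
        exact absurd (ht ▸ hv.closed_unbranched a hc ha) (h.src_branched (hp.src_notMem h1))
      · rw [if_neg h1] at ht
        have h2 : σ.snkPos t ∉ X := ht ▸ haX
        rw [if_neg h2] at hd ⊢
        exact ⟨hd, ht, rfl⟩
    have hfa : (σ.contract D X q (m₀ none)).flow a = σ.flow a := by
      simp [FlowState.contract, haX]
    rw [hfa]
    rcases hv.closed_demand a hc ha with h1 | ⟨h1, t₀, h2⟩
    · refine Or.inl fun t hd ht => ?_
      obtain ⟨h3, h4, h5⟩ := key t hd ht
      rw [h5]; exact h1 t h3 h4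
    · refine Or.inr ⟨h1.mono hal, t₀, fun t htt hd ht => ?_⟩
      obtain ⟨h3, h4, h5⟩ := key t hd ht
      rw [h5]; exact h2 t htt h3 h4
  · simp only [FlowState.contract, Set.mem_ofPred_eq, not_or] at ht ⊢
    rw [hp.eq_zero_of_snk ht.2, if_neg (lt_irrefl _)]
    exact hv.unmoved_out t ht.1 a
  · simp only [FlowState.contract, Set.mem_ofPred_eq, not_or] at ht hd hpos
    rw [hp.eq_zero_of_snk ht.2, if_neg (lt_irrefl _)] at hpos
    by_cases h1 : 0 < m₀ none t'
    · rw [if_pos h1] at hpos; exact absurd hpos (hv.unmoved_out t ht.1 q)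
    · rw [if_neg h1] at hpos
      have h2 : σ.snkPos t' ∉ X := hpos ▸ ht.2
      rw [if_neg h2] at hd
      exact hv.unmoved_alone t ht.1 t' hd hpos

theorem FlowState.IsTree.size_contract_lt (h : σ.IsTree D X q) (hv : σ.Valid D ρ)
    (hp : σ.IsPlan D X q m₀) : (σ.contract D X q (m₀ none)).size ρ < σ.size ρ := by
  classical
  have h1 := card_filter_lt_card_filter (P := fun a => 0 < (σ.contract D X q (m₀ none)).flow a)
    (Q := fun a => 0 < σ.flow a) (fun a ha => (contract_alive.1 ha).1)
    ⟨q, h.alive, fun hq => (contract_alive.1 hq).2 h.tgt_mem⟩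
  have h3 : ∑ t, ρ ((σ.contract D X q (m₀ none)).snkPos t) ≤ ∑ t, ρ (σ.snkPos t) := by
    refine Finset.sum_le_sum fun t _ => ?_
    simp only [FlowState.contract]
    split_ifs with h4
    · have h5 := (hp.reach none t h4).rank_le (ρ := ρ) fun a ha => hv.rank a ha.1
      have h6 := hv.rank q h.alive
      exact h6.le.trans h5
    · exact le_rfl
  unfold size
  omega

/-- Closedness is inherited by the arcs reachable from a closed arc. -/
theorem FlowState.Valid.closed_of_reach (hv : σ.Valid D ρ) {e : A} (hc : e ∈ σ.closed)
    (he : e ∈ σ.alive) {x : V} (hx : D.Reach σ.alive (D.tgt e) x) :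
    ∀ a ∈ σ.alive, D.src a = x → a ∈ σ.closed := by
  induction hx with
  | refl => exact fun a ha hs => hv.closed_succ e hc he a ha hs
  | tail _ hb ih =>
    obtain ⟨b, hb, h1, rfl⟩ := hb
    exact fun a ha hs => hv.closed_succ b (ih b hb h1) hb a ha hs

end Tree

/-! ### Loads within the tree and the routing after a contraction -/

section Tree

set_option linter.unusedSectionVars false

variable {V A S T : Type*} [Fintype A] [Fintype S] [Fintype T] [DecidableEq V]
  {D : ArcDigraph V A} {ρ : V → ℕ} {lab : A → Bool} {σ : FlowState V A S T} {X : Set V} {q : A}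
  {m₀ : Option S → T → ℝ}

/-- The contributions passing through an arc of the tree or entering the tree through it. -/
def FlowState.Through (D : ArcDigraph V A) (σ : FlowState V A S T) (X : Set V) (q : A) (e : A)
    (o : Option S) : Prop :=
  (D.src e ∈ X ∧ D.Reach (σ.treeArcs D X) (σ.treePos D q o) (D.src e)) ∨
    (D.src e ∉ X ∧ o = none)

open scoped Classical in
/-- The load of a transport plan on the arc `e`, as far as the sink `t` is concerned. -/
noncomputable def FlowState.planLoad (D : ArcDigraph V A) (σ : FlowState V A S T) (X : Set V)
    (q : A) (m₀ : Option S → T → ℝ) (e : A) (t : T) : ℝ :=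
  ∑ o, if σ.Through D X q e o ∧ D.Reach (σ.treeArcs D X) (D.tgt e) (σ.snkPos t) then m₀ o t else 0

theorem FlowState.IsPlan.planLoad_nonneg (hp : σ.IsPlan D X q m₀) (e : A) (t : T) :
    0 ≤ σ.planLoad D X q m₀ e t :=
  Finset.sum_nonneg fun o _ => by split_ifs; exacts [hp.nonneg o t, le_rfl]

theorem FlowState.IsPlan.pos_of_planLoad_pos (hp : σ.IsPlan D X q m₀) {e : A} {t : T}
    (h : 0 < σ.planLoad D X q m₀ e t) :
    0 < σ.demand t ∧ σ.snkPos t ∈ X ∧ D.Reach (σ.treeArcs D X) (D.tgt e) (σ.snkPos t) := by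
  classical
  obtain ⟨o, -, ho⟩ : ∃ o ∈ Finset.univ, 0 < (if σ.Through D X q e o ∧
      D.Reach (σ.treeArcs D X) (D.tgt e) (σ.snkPos t) then m₀ o t else 0) := by
    by_contra! hh
    exact absurd h (not_lt.2 (Finset.sum_nonpos hh))
  split_ifs at ho with h1
  · have h2 := hp.snk_mem ho
    have h3 := hp.col t
    rw [if_pos h2] at h3
    refine ⟨?_, h2, h1.2⟩
    rw [← h3]
    exact lt_of_lt_of_le ho (Finset.single_le_sum (f := fun o => m₀ o t)
      (fun o _ => hp.nonneg o t) (Finset.mem_univ o))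
  · exact absurd ho (lt_irrefl _)

theorem FlowState.IsTree.sum_planLoad_le (h : σ.IsTree D X q) (hp : σ.IsPlan D X q m₀) {e : A}
    (he : e ∈ σ.alive) (heX : D.tgt e ∈ X) : ∑ t, σ.planLoad D X q m₀ e t ≤ σ.flow e := by
  classical
  by_cases hs : D.src e ∈ X
  · simpa [planLoad, Through, hs] using hp.load e ⟨he, hs⟩
  · obtain rfl := h.into e he heX hs
    have h1 : ∑ t, m₀ none t = σ.flow e := by
      rw [hp.row_none, inflow, if_neg hs]
    rw [← h1]
    refine Finset.sum_le_sum fun t _ => ?_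
    rw [planLoad, Fintype.sum_option]
    simp only [Through, hs, false_and, false_or, not_false_eq_true, true_and, reduceCtorEq,
      if_false, Finset.sum_const_zero, add_zero]
    split_ifs
    · exact le_rfl
    · exact hp.nonneg _ _

theorem FlowState.Through.trans (h : σ.IsTree D X q) {e e' : A} {o : Option S}
    (ho : σ.Through D X q e o) (he : e ∈ σ.alive) (heX : D.tgt e ∈ X)
    (he' : e' ∈ σ.treeArcs D X) (hr : D.Reach (σ.treeArcs D X) (D.tgt e) (D.src e')) :
    σ.Through D X q e' o := by
  left
  refine ⟨he'.2, ?_⟩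
  rcases ho with ⟨h1, h2⟩ | ⟨h1, rfl⟩
  · exact h2.trans ((reach_arc (show e ∈ σ.treeArcs D X from ⟨he, h1⟩)).trans hr)
  · obtain rfl := h.into e he heX h1
    exact hr

open scoped Classical in
/-- On an arc whose flow may have been increased, the sinks `t` of a set of sinks with
`demand t ≤ β` or of a single sink use at most `β`. -/
theorem FlowState.IsTree.closed_load_le (h : σ.IsTree D X q) (hv : σ.Valid D ρ)
    (hp : σ.IsPlan D X q m₀) {e : A} (he : e ∈ σ.alive) (hc : e ∈ σ.closed)
    (heX : D.tgt e ∈ X) {β : ℝ} (hβ : 0 ≤ β) (P : T → Prop) [DecidablePred P]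
    (load : T → ℝ)
    (hload : ∀ t, load t ≤ σ.planLoad D X q m₀ e t)
    (hP1 : ∀ t, P t → load t ≤ β)
    (hP2 : ∀ t ∈ σ.moved, P t → σ.demand t ≤ β) :
    ∑ t, (if P t then load t else 0) ≤ β := by
  set E := σ.treeArcs D X with hE
  set Q : T → Prop := fun t => P t ∧ 0 < σ.planLoad D X q m₀ e t with hQ
  have hle : ∑ t, (if P t then load t else 0) ≤ ∑ t, if Q t then load t else 0 := by
    refine Finset.sum_le_sum fun t _ => ?_
    by_cases h1 : P t
    · by_cases h2 : 0 < σ.planLoad D X q m₀ e t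
      · rw [if_pos h1, if_pos ⟨h1, h2⟩]
      · rw [if_pos h1, if_neg fun h3 => h2 h3.2]
        exact (hload t).trans (not_lt.1 h2)
    · rw [if_neg h1, if_neg fun h3 => h1 h3.1]
  refine hle.trans ?_
  by_cases hex : ∃ t, Q t
  swap
  · push Not at hex
    rw [Finset.sum_eq_zero fun t _ => if_neg (hex t)]
    exact hβ
  have hQR : ∀ t, Q t → 0 < σ.demand t ∧ σ.snkPos t ∈ X ∧ D.Reach E (D.tgt e) (σ.snkPos t) :=
    fun t ht => hp.pos_of_planLoad_pos ht.2
  -- `t₁` is the first sink in question behind `e`. The tree does not branch, so all others are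
  -- reached through its position.
  obtain ⟨t₁, ht₁, hmin⟩ := Finset.exists_min_image (Finset.univ.filter Q)
    (fun t => ρ (σ.snkPos t)) (by obtain ⟨t, ht⟩ := hex; exact ⟨t, by simpa using ht⟩)
  simp only [Finset.mem_filter, Finset.mem_univ, true_and] at ht₁ hmin
  have hrank : ∀ a ∈ E, ρ (D.src a) < ρ (D.tgt a) := fun a ha => hv.rank a ha.1
  obtain ⟨hd₁, hX₁, hR₁⟩ := hQR t₁ ht₁
  have hreach : ∀ t, Q t → D.Reach E (σ.snkPos t₁) (σ.snkPos t) := by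
    intro t ht
    rcases hR₁.total (hQR t ht).2.2 (fun x _ a ha a' ha' h1 h2 =>
      h.unbranched x (h1 ▸ ha.2) a ha.1 a' ha'.1 h1 h2) with h1 | h1
    · exact h1
    · rw [h1.eq_of_rank_le hrank (hmin t ht)]; exact Reach.refl _ _
  -- The last arc before `t₁`, possibly `e` itself, is closed and carries the whole load in
  -- question.
  obtain ⟨e', he', hc', hte', hthr⟩ : ∃ e' ∈ σ.alive, e' ∈ σ.closed ∧ D.tgt e' = σ.snkPos t₁ ∧
      ∀ o, σ.Through D X q e o → σ.Through D X q e' o := by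
    rcases hR₁.eq_or_tail with h1 | ⟨a, ha, h1, h2⟩
    · exact ⟨e, he, hc, h1, fun o ho => ho⟩
    · exact ⟨a, ha.1, hv.closed_of_reach hc he (h2.mono fun b hb => hb.1) a ha.1 rfl, h1,
        fun o ho => ho.trans h he heX ha h2⟩
  have hsum : ∑ t, (if Q t then load t else 0) ≤ σ.flow e' := by
    refine le_trans ?_ (h.sum_planLoad_le hp he' (hte' ▸ hX₁))
    refine Finset.sum_le_sum fun t _ => ?_
    split_ifs with ht
    · refine (hload t).trans (Finset.sum_le_sum fun o _ => ?_)
      by_cases h1 : σ.Through D X q e o ∧ D.Reach E (D.tgt e) (σ.snkPos t)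
      · rw [if_pos h1, if_pos ⟨hthr o h1.1, hte' ▸ hreach t ht⟩]
      · rw [if_neg h1]; split_ifs; exacts [hp.nonneg o t, le_rfl]
    · exact hp.planLoad_nonneg _ _
  -- Either the demand of some moved sink, which is at most `β`, covers the flow of `e'`, or
  -- `closed_demand` and the solitude of unmoved sinks leave just one sink in question.
  by_cases hgood : ∃ t, Q t ∧ t ∈ σ.moved ∧ σ.flow e' ≤ σ.demand t
  · obtain ⟨t, ht, htm, htd⟩ := hgood
    exact hsum.trans (htd.trans (hP2 t htm ht.1))
  · push Not at hgood
    have hsingle : ∀ t t', Q t → Q t' → t = t' := by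
      have hend : D.DeadEnd σ.alive (σ.snkPos t₁) ∧ ∃ t₀, ∀ t, t ≠ t₀ → 0 < σ.demand t →
          σ.snkPos t = σ.snkPos t₁ → σ.flow e' ≤ σ.demand t := by
        rw [← hte']
        rcases hv.closed_demand e' hc' he' with h1 | h1
        · by_cases hm : t₁ ∈ σ.moved
          · exact absurd (h1 t₁ hd₁ hte'.symm) (not_le.2 (hgood t₁ ht₁ hm))
          · exact ⟨fun a _ => hte' ▸ hv.unmoved_out t₁ hm a, t₁, fun t _ hd hpos => h1 t hd hpos⟩
        · exact h1
      obtain ⟨hend, t₀, ht₀⟩ := hend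
      have hpos : ∀ t, Q t → σ.snkPos t = σ.snkPos t₁ := fun t ht =>
        (hend.eq_of_reach ((hreach t ht).mono fun b hb => hb.1)).symm
      intro t t' ht ht'
      by_cases hm : t ∈ σ.moved
      · by_cases hm' : t' ∈ σ.moved
        · have key : ∀ t, Q t → t ∈ σ.moved → t = t₀ := fun t ht hm => by
            by_contra hne
            exact absurd (ht₀ t hne (hQR t ht).1 (hpos t ht)) (not_le.2 (hgood t ht hm))
          rw [key t ht hm, key t' ht' hm']
        · exact hv.unmoved_alone t' hm' t (hQR t ht).1 ((hpos t ht).trans (hpos t' ht').symm)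
      · exact (hv.unmoved_alone t hm t' (hQR t' ht').1
          ((hpos t' ht').trans (hpos t ht).symm)).symm
    rw [Finset.sum_eq_single t₁ (fun t _ hne => if_neg fun ht => hne (hsingle t t₁ ht ht₁))
      (by simp), if_pos ht₁]
    exact hP1 t₁ ht₁.1

/-- Sources in the tree follow the plan; walks serving a residual demand are prolonged by `q` and a
walk inside the tree. An unmoved sink of the tree is assigned the layer of `q`, in which its
residual demand arrives. What it obtains from sources of the tree through the other layer is
subtracted from its demand to give its amount. -/
theorem FlowState.IsTree.routable_of_contract
    (hlab : ∀ a a', D.tgt a = D.src a' → lab a = lab a') (h : σ.IsTree D X q)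
    (hv : σ.Valid D ρ) (hp : σ.IsPlan D X q m₀)
    (hr : (σ.contract D X q (m₀ none)).Routable D lab) : σ.Routable D lab := by
  classical
  obtain ⟨m', path', lay', q', hr⟩ := hr
  set E := σ.treeArcs D X with hE
  have htw : ∀ u v, ∃ p, D.Reach E u v → D.IsWalk u v p ∧
      ∀ a ∈ p, a ∈ E ∧ D.Reach E u (D.src a) ∧ D.Reach E (D.tgt a) v := by
    intro u v
    by_cases huv : D.Reach E u v
    · obtain ⟨p, hp⟩ := huv.exists_isWalk; exact ⟨p, fun _ => hp⟩
    · exact ⟨[], fun hh => absurd hh huv⟩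
  choose tw htw using htw
  set m : S → T → ℝ := fun s t => m' s t + m₀ (some s) t with hm
  set path : S → T → List A := fun s t => if σ.srcPos s ∈ X then tw (σ.srcPos s) (σ.snkPos t)
    else if σ.snkPos t ∈ X then path' s t ++ q :: tw (D.tgt q) (σ.snkPos t) else path' s t
    with hpath
  have hm'X : ∀ s t, σ.srcPos s ∈ X → m' s t = 0 := by
    intro s t hs
    have h1 : ∑ t, m' s t = 0 := by rw [hr.row]; simp [FlowState.contract, hs]
    exact (Finset.sum_eq_zero_iff_of_nonneg fun t _ => hr.nonneg _ t).1 h1 t (Finset.mem_univ _)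
  have hcol' : ∀ t, σ.snkPos t ∈ X → ∑ s, m' s t = m₀ none t := by
    intro t ht; rw [hr.col]; simp [FlowState.contract, ht]
  have hm'le : ∀ s t, σ.snkPos t ∈ X → m' s t ≤ m₀ none t := by
    intro s t ht
    rw [← hcol' t ht]
    exact Finset.single_le_sum (f := fun s => m' s t) (fun s _ => hr.nonneg s t)
      (Finset.mem_univ s)
  have hm0 : ∀ s t, 0 ≤ m s t := fun s t => add_nonneg (hr.nonneg s t) (hp.nonneg _ t)
  have hcol : ∀ t, ∑ s, m s t = σ.demand t := by
    intro t
    rw [Finset.sum_add_distrib]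
    by_cases ht : σ.snkPos t ∈ X
    · rw [hcol' t ht, hp.demand_eq ht]
    · rw [Finset.sum_eq_zero (f := fun s => m₀ (some s) t) fun s _ => hp.eq_zero_of_snk ht _,
        hr.col]
      simp [FlowState.contract, ht]
  have hEX : ∀ a ∈ E, D.tgt a ∈ X := fun a ha => h.out a ha.1 ha.2
  have hdead' : ∀ s t, 0 < m' s t → ∀ a ∈ path' s t, a ∈ σ.alive ∧ D.tgt a ∉ X := fun s t hst a ha =>
    contract_alive.1 (hr.walk_alive s t hst a ha)
  -- the residual demand of a sink in the tree
  have hres : ∀ s t, σ.snkPos t ∈ X → 0 < m' s t → 0 < m₀ none t ∧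
      D.IsWalk (σ.srcPos s) (D.src q) (path' s t) := by
    intro s t ht hst
    have h1 := lt_of_lt_of_le hst (hm'le s t ht)
    have h2 := hr.walk s t hst
    simp only [FlowState.contract, h1, if_true] at h2
    exact ⟨h1, h2⟩
  have hwalk : ∀ s t, 0 < m s t →
      D.IsWalk (σ.srcPos s) (σ.snkPos t) (path s t) ∧ ∀ a ∈ path s t, a ∈ σ.alive := by
    intro s t hst
    by_cases hs : σ.srcPos s ∈ X
    · simp only [hm, hm'X s t hs, zero_add] at hst
      have h1 := htw _ _ (hp.reach _ t hst)
      simp only [hpath, hs, if_true]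
      exact ⟨h1.1, fun a ha => (h1.2 a ha).1.1⟩
    · have hst' : 0 < m' s t := by simpa [hm, hp.eq_zero_of_src hs] using hst
      by_cases ht : σ.snkPos t ∈ X
      · obtain ⟨h1, h2⟩ := hres s t ht hst'
        have h3 := htw _ _ (hp.reach _ t h1)
        simp only [hpath, hs, if_false, ht, if_true]
        refine ⟨h2.append ⟨rfl, h3.1⟩, fun a ha => ?_⟩
        rcases List.mem_append.1 ha with ha | ha
        · exact (hdead' s t hst' a ha).1
        · rcases List.mem_cons.1 ha with rfl | ha
          · exact h.alive
          · exact (h3.2 a ha).1.1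
      · simp only [hpath, hs, if_false, ht]
        refine ⟨?_, fun a ha => (hdead' s t hst' a ha).1⟩
        have h2 := hr.walk s t hst'
        simpa [FlowState.contract, hp.eq_zero_of_snk ht] using h2
  -- loads outside and inside the tree
  have hload_out : ∀ e t, (D.tgt e ∉ X ∨ σ.snkPos t ∉ X) →
      arcLoad m path e t = arcLoad m' path' e t := by
    intro e t het
    refine Finset.sum_congr rfl fun s _ => ?_
    by_cases hs : σ.srcPos s ∈ X
    · have h1 : m' s t = 0 := hm'X s t hs
      rcases het with he | ht
      · simp only [hm, h1, zero_add, ite_self]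
        split_ifs with h2
        · by_contra hne
          have h3 := lt_of_le_of_ne (hp.nonneg (some s) t) (Ne.symm hne)
          simp only [hpath, hs, if_true] at h2
          exact he (hEX e ((htw _ _ (hp.reach _ t h3)).2 e h2).1)
        · rfl
      · simp [hm, h1, hp.eq_zero_of_snk ht]
    · have h1 : m s t = m' s t := by simp [hm, hp.eq_zero_of_src hs]
      rw [h1]
      by_cases h0 : m' s t = 0
      · simp [h0]
      have hst := lt_of_le_of_ne (hr.nonneg s t) (Ne.symm h0)
      have h2 : e ∈ path s t ↔ e ∈ path' s t := by
        by_cases ht : σ.snkPos t ∈ X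
        · have he := het.resolve_right (not_not.2 ht)
          simp only [hpath, hs, if_false, ht, if_true, List.mem_append, List.mem_cons]
          have h3 := htw _ _ (hp.reach _ t (hres s t ht hst).1)
          constructor
          · rintro (h4 | rfl | h4)
            · exact h4
            · exact absurd h.tgt_mem he
            · exact absurd (hEX e (h3.2 e h4).1) he
          · exact Or.inl
        · simp [hpath, hs, ht]
      simp only [h2]
  have hload_in : ∀ e t, D.tgt e ∈ X → arcLoad m path e t ≤ σ.planLoad D X q m₀ e t := by
    intro e t heX
    by_cases ht : σ.snkPos t ∈ X
    swap
    · rw [hload_out e t (Or.inr ht),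
        hr.arcLoad_eq_zero_of_dead (fun hh => (contract_alive.1 hh).2 heX)]
      exact hp.planLoad_nonneg _ _
    rw [planLoad, Fintype.sum_option]
    -- The inflow part of the plan for `t` is exactly what the walks from outside deliver through
    -- `q`.
    have h1 : (if σ.Through D X q e none ∧ D.Reach E (D.tgt e) (σ.snkPos t) then m₀ none t else 0)
        = ∑ s, if σ.Through D X q e none ∧ D.Reach E (D.tgt e) (σ.snkPos t) then m' s t else 0 := by
      split_ifs
      · exact (hcol' t ht).symm
      · simp
    rw [← hE, h1, ← Finset.sum_add_distrib]
    refine Finset.sum_le_sum fun s _ => ?_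
    have e1 : 0 ≤ if σ.Through D X q e none ∧ D.Reach E (D.tgt e) (σ.snkPos t) then m' s t
        else 0 := by split_ifs; exacts [hr.nonneg s t, le_rfl]
    have e2 : 0 ≤ if σ.Through D X q e (some s) ∧ D.Reach E (D.tgt e) (σ.snkPos t)
        then m₀ (some s) t else 0 := by split_ifs; exacts [hp.nonneg _ t, le_rfl]
    by_cases hmem : e ∈ path s t
    swap
    · rw [if_neg hmem]; linarith
    rw [if_pos hmem]
    by_cases hs : σ.srcPos s ∈ X
    · have h2 : m s t = m₀ (some s) t := by simp [hm, hm'X s t hs]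
      by_cases h0 : m₀ (some s) t = 0
      · rw [h2, h0] ; simpa [h0] using e1
      have hst := lt_of_le_of_ne (hp.nonneg (some s) t) (Ne.symm h0)
      simp only [hpath, hs, if_true] at hmem
      obtain ⟨h3, h4, h5⟩ := (htw _ _ (hp.reach _ t hst)).2 e hmem
      rw [h2, if_pos (c := σ.Through D X q e (some s) ∧ _) ⟨Or.inl ⟨h3.2, h4⟩, h5⟩]
      linarith
    · have h2 : m s t = m' s t := by simp [hm, hp.eq_zero_of_src hs]
      by_cases h0 : m' s t = 0
      · rw [h2, h0] ; simpa [h0] using e2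
      have hst := lt_of_le_of_ne (hr.nonneg s t) (Ne.symm h0)
      obtain ⟨h6, -⟩ := hres s t ht hst
      have h7 := hp.reach _ t h6
      simp only [hpath, hs, if_false, ht, if_true, List.mem_append, List.mem_cons] at hmem
      rw [h2, if_pos (c := σ.Through D X q e none ∧ _)]
      · linarith
      · rcases hmem with h8 | rfl | h8
        · exact absurd heX (hdead' s t hst e h8).2
        · exact ⟨Or.inr ⟨hp.src_notMem h6, rfl⟩, h7⟩
        · obtain ⟨h3, h4, h5⟩ := (htw _ _ h7).2 e h8
          exact ⟨Or.inl ⟨h3.2, h4⟩, h5⟩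
  -- foreign contributions
  set F : S → T → Prop := fun s t => ∃ a ∈ tw (σ.srcPos s) (σ.snkPos t), lab a ≠ lab q with hF
  set lay : T → Bool := fun t => if σ.snkPos t ∈ X then lab q else lay' t with hlay
  set qq : T → ℝ := fun t => if σ.snkPos t ∈ X then (if t ∈ σ.moved then σ.demand t else
    σ.demand t - ∑ s, if F s t then m₀ (some s) t else 0) else q' t with hqq
  have hlabel : ∀ s t, 0 < m s t → ∀ a ∈ path s t, ∀ b ∈ path s t, lab a = lab b :=
    fun s t hst => (hwalk s t hst).1.label_const hlab
  have hresF : ∀ s t, σ.srcPos s ∉ X → σ.snkPos t ∈ X → 0 < m s t → ∀ e ∈ path s t,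
      lab e = lab q := by
    intro s t hs ht hst e he
    refine hlabel s t hst e he q ?_
    simp [hpath, hs, ht]
  have hq_own : ∀ t ∉ σ.moved, ∀ e, lab e = lay t → arcLoad m path e t ≤ qq t := by
    intro t htm e he
    by_cases ht : σ.snkPos t ∈ X
    · simp only [hlay, ht, if_true] at he
      simp only [hqq, ht, if_true, htm, if_false]
      rw [le_sub_iff_add_le, ← hcol t, arcLoad, ← Finset.sum_add_distrib]
      refine Finset.sum_le_sum fun s _ => ?_
      have e1 : m₀ (some s) t ≤ m s t := le_add_of_nonneg_left (hr.nonneg s t)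
      by_cases hFs : F s t
      · rw [if_pos hFs]
        by_cases hz : m₀ (some s) t = 0
        · rw [hz]; split_ifs <;> linarith [hm0 s t]
        have hpos := lt_of_le_of_ne (hp.nonneg (some s) t) (Ne.symm hz)
        have hs : σ.srcPos s ∈ X := by
          by_contra hs; exact hz (hp.eq_zero_of_src hs t)
        obtain ⟨a, ha, hla⟩ := hFs
        rw [if_neg, zero_add]
        · exact e1
        · intro hmem
          refine hla ((hlabel s t (lt_of_lt_of_le hpos e1) a ?_ e hmem).trans he)
          simpa [hpath, hs] using ha
      · rw [if_neg hFs, add_zero]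
        split_ifs; exacts [le_rfl, hm0 s t]
    · rw [hload_out e t (Or.inr ht)]
      simp only [hlay, ht, if_false] at he
      simp only [hqq, ht, if_false]
      exact hr.load_le_q t (by simp [FlowState.contract, htm, ht]) e he
  have hq_for : ∀ t ∉ σ.moved, ∀ e, lab e ≠ lay t →
      arcLoad m path e t ≤ σ.demand t - qq t := by
    intro t htm e he
    by_cases ht : σ.snkPos t ∈ X
    · simp only [hlay, ht, if_true] at he
      simp only [hqq, ht, if_true, htm, if_false, sub_sub_cancel]
      refine Finset.sum_le_sum fun s _ => ?_
      have e2 : 0 ≤ if F s t then m₀ (some s) t else 0 := by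
        split_ifs; exacts [hp.nonneg _ t, le_rfl]
      by_cases hmem : e ∈ path s t
      swap
      · rw [if_neg hmem]; exact e2
      rw [if_pos hmem]
      by_cases hz : m s t = 0
      · rw [hz]; exact e2
      have hpos := lt_of_le_of_ne (hm0 s t) (Ne.symm hz)
      have hs : σ.srcPos s ∈ X := by
        by_contra hs; exact he (hresF s t hs ht hpos e hmem)
      rw [if_pos ⟨e, by simpa [hpath, hs] using hmem, he⟩]
      simp [hm, hm'X s t hs]
    · rw [hload_out e t (Or.inr ht)]
      simp only [hlay, ht, if_false] at he
      simp only [hqq, ht, if_false]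
      have := hr.load_le_sub t (by simp [FlowState.contract, htm, ht]) e he
      simpa [FlowState.contract, ht] using this
  have hq_moved : ∀ t ∈ σ.moved, qq t = σ.demand t := by
    intro t htm
    by_cases ht : σ.snkPos t ∈ X
    · simp [hqq, ht, htm]
    · simp only [hqq, ht, if_false]
      have := hr.q_moved t (Or.inl htm)
      simpa [FlowState.contract, ht] using this
  have hdead : ∀ e, e ∉ σ.alive → ∀ t, arcLoad m path e t = 0 := fun e he t =>
    arcLoad_eq_zero hm0 fun s hs hmem => he ((hwalk s t hs).2 e hmem)
  refine ⟨m, path, lay, qq, hm0, fun s => ?_, hcol, fun s t hst => (hwalk s t hst).1,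
    fun s t hst => (hwalk s t hst).2, hq_moved, hq_own, hq_for, fun e β hβ => ?_,
    fun e t t' h1 h2 h3 h4 => ?_⟩
  · rw [Finset.sum_add_distrib, hr.row, hp.row_some]
    by_cases hs : σ.srcPos s ∈ X <;> simp [FlowState.contract, hs]
  · by_cases heX : D.tgt e ∈ X
    · by_cases he : e ∈ σ.alive
      swap
      · simp only [hdead e he, ite_self, Finset.sum_const_zero]
        linarith [hv.cap_nonneg e]
      by_cases hc : e ∈ σ.closed
      · have h1 := h.closed_load_le hv hp he hc heX hβ (fun t => qq t ≤ β ∧ σ.Own lab lay e t)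
          (fun t => arcLoad m path e t) (fun t => hload_in e t heX) (fun t ht => ?_)
          (fun t htm ht => ?_)
        · have := hv.cap_nonneg e
          linarith
        · by_cases htm : t ∈ σ.moved
          · have h2 := arcLoad_le_sum hm0 path e t
            rw [hcol, ← hq_moved t htm] at h2
            exact h2.trans ht.1
          · exact (hq_own t htm e (ht.2.resolve_left htm)).trans ht.1
        · rw [← hq_moved t htm]; exact ht.1
      · have h1 := h.sum_planLoad_le hp he heX
        have h2 : σ.cap e = σ.flow e := by simp [FlowState.cap, hc]
        rw [h2]
        have h3 : ∑ t, (if qq t ≤ β ∧ σ.Own lab lay e t then arcLoad m path e t else 0) ≤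
            ∑ t, σ.planLoad D X q m₀ e t := Finset.sum_le_sum fun t _ => by
          split_ifs
          · exact hload_in e t heX
          · exact hp.planLoad_nonneg e t
        linarith
    · have h1 : (σ.contract D X q (m₀ none)).cap e = σ.cap e := by
        simp [FlowState.cap, FlowState.contract, heX]
      rw [← h1]
      refine le_trans (Finset.sum_le_sum fun t _ => ?_) (hr.own e β hβ)
      rw [hload_out e t (Or.inl heX)]
      have e2 := arcLoad_nonneg hr.nonneg path' e t
      by_cases h2 : qq t ≤ β ∧ σ.Own lab lay e t
      · rw [if_pos h2, if_pos]
        -- A sink of the tree counts as moved after the contraction, its amount being the residual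
        -- demand. This is at most `qq t`, since only contributions of tree sources have been
        -- subtracted from the demand.
        by_cases ht : σ.snkPos t ∈ X
        · have h3 : t ∈ (σ.contract D X q (m₀ none)).moved := Or.inr ht
          refine ⟨le_trans ?_ h2.1, Or.inl h3⟩
          rw [hr.q_moved t h3]
          have h4 := hp.demand_eq ht
          have h5 : (σ.contract D X q (m₀ none)).demand t = m₀ none t := by
            simp [FlowState.contract, ht]
          rw [h5]
          simp only [hqq, ht, if_true]
          split_ifs
          · have : 0 ≤ ∑ s, m₀ (some s) t := Finset.sum_nonneg fun s _ => hp.nonneg _ t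
            linarith
          · have : (∑ s, if F s t then m₀ (some s) t else 0) ≤ ∑ s, m₀ (some s) t :=
              Finset.sum_le_sum fun s _ => by split_ifs; exacts [le_rfl, hp.nonneg _ t]
            linarith
        · simp only [hqq, ht, if_false] at h2
          refine ⟨h2.1, ?_⟩
          rcases h2.2 with h3 | h3
          · exact Or.inl (Or.inl h3)
          · exact Or.inr (by simpa [hlay, ht] using h3)
      · rw [if_neg h2]; split_ifs; exacts [e2, le_rfl]
  · simp only [FlowState.Own, not_or] at h1 h2
    by_cases heX : D.tgt e ∈ X
    -- An unmoved sink of the tree sits at a dead end. The tree has only one, and an unmoved sink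
    -- shares its position with no other demand.
    · have key : ∀ t, t ∉ σ.moved → 0 < arcLoad m path e t → 0 < σ.demand t ∧ σ.snkPos t ∈ X ∧
          D.DeadEnd σ.alive (σ.snkPos t) := by
        intro t htm hpos
        obtain ⟨h5, h6, -⟩ := hp.pos_of_planLoad_pos (lt_of_lt_of_le hpos (hload_in e t heX))
        exact ⟨h5, h6, fun a _ => hv.unmoved_out t htm a⟩
      obtain ⟨k1, k2, k3⟩ := key t h1.1 h3
      obtain ⟨l1, l2, l3⟩ := key t' h2.1 h4
      exact hv.unmoved_alone t' h2.1 t k1 (h.end_unique _ k2 _ l2 k3 l3)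
    -- Outside the tree, walks to a sink of the tree lead to the tail of `q`, so they stay in the
    -- layer of `q`, which is the sink's own.
    · have key : ∀ t, lab e ≠ lay t → 0 < arcLoad m path e t → σ.snkPos t ∉ X := by
        intro t hl hpos ht
        simp only [hlay, ht, if_true] at hl
        rw [hload_out e t (Or.inl heX)] at hpos
        refine hpos.ne' (arcLoad_eq_zero hr.nonneg fun s hst hmem => ?_)
        exact hl ((hres s t ht hst).2.label_eq hlab rfl e hmem)
      have k1 := key t h1.2 h3
      have k2 := key t' h2.2 h4
      rw [hload_out e _ (Or.inl heX)] at h3 h4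
      refine hr.foreign e t t' ?_ ?_ h3 h4
      · rintro ((h5 | h5) | h5)
        · exact h1.1 h5
        · exact k1 h5
        · exact h1.2 (by simpa [hlay, k1] using h5)
      · rintro ((h5 | h5) | h5)
        · exact h2.1 h5
        · exact k2 h5
        · exact h2.2 (by simpa [hlay, k2] using h5)

end Tree

/-! ### Regular vertices, entries and the augmenting circulation -/

section Augment

set_option linter.unusedSectionVars false

variable {V A : Type*} {D : ArcDigraph V A} {E : Set A} {ρ : V → ℕ}

/-- Only vertices with at most one leaving arc in `E` are reachable from `v`. -/
def Regular (D : ArcDigraph V A) (E : Set A) (v : V) : Prop :=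
  ∀ x, D.Reach E v x → D.Unbranched E x

/-- A vertex that is entered but not left by arcs of `E`. -/
def IsEnd (D : ArcDigraph V A) (E : Set A) (w : V) : Prop :=
  D.DeadEnd E w ∧ ∃ a ∈ E, D.tgt a = w

/-- The arc `a` enters the tree of the regular vertices from which `w` is reachable. -/
def IsEntry (D : ArcDigraph V A) (E : Set A) (w : V) (a : A) : Prop :=
  a ∈ E ∧ ¬ D.Regular E (D.src a) ∧ D.Regular E (D.tgt a) ∧ D.Reach E (D.tgt a) w

theorem Regular.of_reach {v x : V} (h : D.Regular E v) (hr : D.Reach E v x) : D.Regular E x :=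
  fun _ hy => h _ (hr.trans hy)

theorem Regular.total {u v w : V} (h : D.Regular E u) (huv : D.Reach E u v)
    (huw : D.Reach E u w) : D.Reach E v w ∨ D.Reach E w v :=
  huv.total huw fun x hx a ha a' ha' h1 h2 => h x hx a ha a' ha' h1 h2

/-- Thus an arc is an entry for at most one end, which the count in `exists_arc_choice` needs. -/
theorem Regular.end_unique {u v w : V} (h : D.Regular E u) (huv : D.Reach E u v)
    (huw : D.Reach E u w) (hv : D.DeadEnd E v) (hw : D.DeadEnd E w) : v = w := by
  rcases h.total huv huw with h1 | h1
  · exact hv.eq_of_reach h1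
  · exact (hw.eq_of_reach h1).symm

theorem Unbranched.regular {a : A} (ha : a ∈ E) (h : D.Unbranched E (D.src a))
    (ht : D.Regular E (D.tgt a)) : D.Regular E (D.src a) := by
  intro x hx
  rcases hx.eq_or_head with rfl | ⟨a', ha', h1, h2⟩
  · exact h
  · rw [h a' ha' a ha h1 rfl] at h2; exact ht x h2

theorem IsEntry.branched {w : V} {a : A} (h : D.IsEntry E w a) :
    ¬ D.Unbranched E (D.src a) :=
  fun hu => h.2.1 (hu.regular h.1 h.2.2.1)

/-- The tree consists of all regular vertices leading to `w`. If no arc enters it, any arc into `w`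
can serve as `q`: its tail is then in the tree and the inflow is zero. -/
theorem exists_isTree {S T : Type*} {σ : FlowState V A S T} {w : V} (hw : D.IsEnd σ.alive w)
    (hent : ∀ a a', D.IsEntry σ.alive w a → D.IsEntry σ.alive w a' → a = a') :
    ∃ X q, σ.IsTree D X q := by
  set X : Set V := {v | D.Regular σ.alive v ∧ D.Reach σ.alive v w} with hX
  have hentry : ∀ a ∈ σ.alive, D.tgt a ∈ X → D.src a ∉ X → D.IsEntry σ.alive w a :=
    fun a ha ht hs => ⟨ha, fun hr => hs ⟨hr, (reach_arc ha).trans ht.2⟩, ht.1, ht.2⟩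
  obtain ⟨q, hq, hqX, hinto⟩ : ∃ q ∈ σ.alive, D.tgt q ∈ X ∧
      ∀ a ∈ σ.alive, D.tgt a ∈ X → D.src a ∉ X → a = q := by
    by_cases hex : ∃ q, D.IsEntry σ.alive w q
    · obtain ⟨q, hq⟩ := hex
      exact ⟨q, hq.1, hq.2.2, fun a ha ht hs => hent a q (hentry a ha ht hs) hq⟩
    · push Not at hex
      obtain ⟨a, ha, haw⟩ := hw.2
      refine ⟨a, ha, ⟨?_, ?_⟩, fun a ha ht hs => absurd (hentry a ha ht hs) (hex a)⟩
      · intro x hx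
        rw [haw] at hx
        rw [← hw.1.eq_of_reach hx]
        exact hw.1.unbranched
      · rw [haw]; exact Reach.refl _ _
  refine ⟨X, q, fun a ha hs => ⟨hs.1.of_reach (reach_arc ha), ?_⟩,
    fun v hv => hv.1 v (Reach.refl _ _), hinto, hq, hqX,
    fun hs => (hentry q hq hqX hs).branched, fun v hv v' hv' h1 h2 => ?_⟩
  · rcases hs.2.eq_or_head with h1 | ⟨a', ha', h1, h2⟩
    · exact absurd h1 (hw.1 a ha)
    · rwa [hs.1 _ (Reach.refl _ _) a' ha' a ha h1 rfl] at h2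
  · rw [h1.eq_of_reach hv.2, h2.eq_of_reach hv'.2]

open scoped Classical in
/-- If every end has two entries, then every branching vertex can be assigned a leaving arc and
every end an entry such that the assigned arcs are distinct. -/
theorem exists_arc_choice [Fintype A]
    (hent : ∀ w, D.IsEnd E w → ∃ a a', a ≠ a' ∧ D.IsEntry E w a ∧ D.IsEntry E w a') :
    ∃ ch : {v // ¬ D.Unbranched E v ∨ D.IsEnd E v} → A, Function.Injective ch ∧
      (∀ v, ¬ D.IsEnd E v.1 → ch v ∈ E ∧ D.src (ch v) = v.1) ∧
      ∀ v, D.IsEnd E v.1 → D.IsEntry E v.1 (ch v) := by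
  set t : {v // ¬ D.Unbranched E v ∨ D.IsEnd E v} → Finset A := fun v =>
    if D.IsEnd E v then Finset.univ.filter (D.IsEntry E v)
    else Finset.univ.filter fun a => a ∈ E ∧ D.src a = v with ht
  have ht1 : ∀ v a, D.IsEnd E v.1 → (a ∈ t v ↔ D.IsEntry E v a) := fun v a h => by
    simp [ht, h]
  have ht2 : ∀ v a, ¬ D.IsEnd E v.1 → (a ∈ t v ↔ a ∈ E ∧ D.src a = v) := fun v a h => by
    simp [ht, h]
  -- Hall's condition by double counting: every claimant has at least two candidate arcs, and an arc
  -- is a candidate for at most two claimants, namely its tail and the only end to which its head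
  -- leads.
  obtain ⟨ch, hinj, hch⟩ := (Finset.all_card_le_biUnion_card_iff_exists_injective t).1 (by
    intro s
    have := Finset.card_mul_le_card_mul (s := s) (t := s.biUnion t) (m := 2) (n := 2)
      (fun v a => a ∈ t v) (fun v hv => by
        have h1 : Finset.bipartiteAbove (fun v a => a ∈ t v) (s.biUnion t) v = t v := by
          ext a
          simp only [Finset.mem_bipartiteAbove, Finset.mem_biUnion]
          exact ⟨fun h => h.2, fun h => ⟨⟨v, hv, h⟩, h⟩⟩
        rw [h1, Nat.succ_le_iff, Finset.one_lt_card]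
        by_cases hvE : D.IsEnd E v
        · obtain ⟨a, a', hne, h2, h3⟩ := hent v hvE
          exact ⟨a, (ht1 v a hvE).2 h2, a', (ht1 v a' hvE).2 h3, hne⟩
        · have h4 := v.2.resolve_right hvE
          unfold Unbranched at h4
          push Not at h4
          obtain ⟨a, ha, a', ha', h5, h6, hne⟩ := h4
          exact ⟨a, (ht2 v a hvE).2 ⟨ha, h5⟩, a', (ht2 v a' hvE).2 ⟨ha', h6⟩, hne⟩)
      (fun a _ => by
        by_contra hlt
        rw [not_le, Finset.two_lt_card] at hlt
        obtain ⟨x, hx, y, hy, z, hz, hxy, hxz, hyz⟩ := hlt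
        simp only [Finset.mem_bipartiteBelow] at hx hy hz
        have k1 : ∀ x y, a ∈ t x → a ∈ t y → D.IsEnd E x.1 → D.IsEnd E y.1 → x = y := by
          intro x y hx hy h1 h2
          have h3 := (ht1 x a h1).1 hx
          have h4 := (ht1 y a h2).1 hy
          exact Subtype.ext (h3.2.2.1.end_unique h3.2.2.2 h4.2.2.2 h1.1 h2.1)
        have k2 : ∀ x y, a ∈ t x → a ∈ t y → ¬ D.IsEnd E x.1 → ¬ D.IsEnd E y.1 → x = y := by
          intro x y hx hy h1 h2
          exact Subtype.ext (((ht2 x a h1).1 hx).2.symm.trans ((ht2 y a h2).1 hy).2)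
        by_cases h1 : D.IsEnd E x.1 <;> by_cases h2 : D.IsEnd E y.1 <;>
          by_cases h3 : D.IsEnd E z.1
        · exact hxy (k1 x y hx.2 hy.2 h1 h2)
        · exact hxy (k1 x y hx.2 hy.2 h1 h2)
        · exact hxz (k1 x z hx.2 hz.2 h1 h3)
        · exact hyz (k2 y z hy.2 hz.2 h2 h3)
        · exact hyz (k1 y z hy.2 hz.2 h2 h3)
        · exact hxz (k2 x z hx.2 hz.2 h1 h3)
        · exact hxy (k2 x y hx.2 hy.2 h1 h2)
        · exact hxy (k2 x y hx.2 hy.2 h1 h2))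
    omega)
  exact ⟨ch, hinj, fun v hv => (ht2 v _ hv).1 (hch v), fun v hv => (ht1 v _ hv).1 (hch v)⟩

open scoped Classical in
/-- Following selected arcs from `v` leads to a dead end; `F` is the flow along this path. -/
theorem exists_path_flow [Fintype V] [Fintype A] [DecidableEq V]
    (hρ : ∀ a ∈ E, ρ (D.src a) < ρ (D.tgt a)) {sel : A → Prop}
    (hsel : ∀ v, ¬ D.DeadEnd E v → ∃ a ∈ E, D.src a = v ∧ sel a) :
    ∀ (n : ℕ) (v : V), Finset.univ.sup ρ - ρ v = n → ∃ (F : A → ℝ) (z : V), D.DeadEnd E z ∧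
      (v = z ∨ D.IsEnd E z) ∧ D.Reach E v z ∧ (∀ a, 0 ≤ F a) ∧
      (∀ a, F a ≠ 0 → a ∈ E ∧ sel a ∧ D.Reach E v (D.src a)) ∧
      ∀ x, D.net F x = (if v = x then 1 else 0) - if z = x then 1 else 0 := by
  intro n
  induction n using Nat.strong_induction_on with
  | _ n ih =>
  intro v hn
  by_cases hv : D.DeadEnd E v
  · exact ⟨fun _ => 0, v, hv, Or.inl rfl, Reach.refl _ _, fun _ => le_rfl, by simp,
      fun x => by simp [net]⟩
  · obtain ⟨e, he, rfl, hse⟩ := hsel v hv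
    have h1 := hρ e he
    have h2 : ρ (D.tgt e) ≤ Finset.univ.sup ρ := Finset.le_sup (Finset.mem_univ _)
    obtain ⟨F, z, hz, hz', hr, hF0, hF, hnet⟩ := ih _ (by omega) (D.tgt e) rfl
    refine ⟨fun a => F a + if a = e then 1 else 0, z, hz, Or.inr ⟨hz, ?_⟩,
      (reach_arc he).trans hr, fun a => ?_, fun a ha => ?_, fun x => ?_⟩
    · rcases hz' with rfl | hz'
      · exact ⟨e, he, rfl⟩
      · exact hz'.2
    · have := hF0 a
      show 0 ≤ F a + _
      split_ifs <;> linarith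
    · by_cases hae : a = e
      · rw [hae]; exact ⟨he, hse, Reach.refl _ _⟩
      · simp only [hae, if_false, add_zero] at ha
        obtain ⟨h3, h4, h5⟩ := hF a ha
        exact ⟨h3, h4, (reach_arc he).trans h5⟩
    · rw [net_add, net_single, hnet]; ring

/-- The sum of `g (φ w) - g w` over the periodic points of `φ` vanishes. -/
theorem sum_periodicPts_sub {α : Type*} [Fintype α] (φ : α → α) (g : α → ℝ)
    [DecidablePred (· ∈ Function.periodicPts φ)] :
    ∑ w with w ∈ Function.periodicPts φ, (g (φ w) - g w) = 0 := by
  rw [Finset.sum_sub_distrib, sub_eq_zero]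
  have hb := Function.bijOn_periodicPts φ
  refine Finset.sum_bij (fun w _ => φ w) (fun w hw => ?_) (fun w hw w' hw' h => ?_)
    (fun w hw => ?_) (fun _ _ => rfl)
  · simp only [Finset.mem_filter, Finset.mem_univ, true_and] at hw ⊢
    exact hb.mapsTo hw
  · simp only [Finset.mem_filter, Finset.mem_univ, true_and] at hw hw'
    exact hb.injOn hw hw' h
  · simp only [Finset.mem_filter, Finset.mem_univ, true_and] at hw
    obtain ⟨w', hw', rfl⟩ := hb.surjOn hw
    exact ⟨w', by simpa using hw', rfl⟩

theorem exists_mem_periodicPts {α : Type*} [Finite α] [Nonempty α] (φ : α → α) :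
    ∃ w, w ∈ Function.periodicPts φ := by
  obtain ⟨x⟩ := ‹Nonempty α›
  obtain ⟨m, n, hmn, h⟩ := Finite.exists_ne_map_eq_of_infinite fun n : ℕ => φ^[n] x
  wlog hlt : m < n generalizing m n
  · exact this n m hmn.symm h.symm (lt_of_le_of_ne (not_lt.1 hlt) hmn.symm)
  refine ⟨φ^[m] x, n - m, Nat.sub_pos_of_lt hlt, ?_⟩
  rw [Function.IsPeriodicPt, Function.IsFixedPt, ← Function.iterate_add_apply,
    Nat.sub_add_cancel hlt.le, h]

open scoped Classical in
/-- If every end has two entries, there is a circulation that increases the flow only on arcs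
leading to regular vertices. -/
theorem exists_augmenting [Fintype V] [Fintype A] [DecidableEq V]
    (hρ : ∀ a ∈ E, ρ (D.src a) < ρ (D.tgt a)) (hE : E.Nonempty)
    (hent : ∀ w, D.IsEnd E w → ∃ a a', a ≠ a' ∧ D.IsEntry E w a ∧ D.IsEntry E w a') :
    ∃ δ : A → ℝ, (∀ v, D.net δ v = 0) ∧ (∀ a, δ a ≠ 0 → a ∈ E) ∧
      (∀ a, ¬ D.Regular E (D.tgt a) → δ a ≤ 0) ∧ ∃ a, δ a < 0 := by
  obtain ⟨ch, hinj, hch1, hch2⟩ := exists_arc_choice hent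
  -- A branching vertex may be left only by its chosen arc; elsewhere there is at most one leaving
  -- arc anyway.
  set sel : A → Prop := fun a => ∀ hb : ¬ D.Unbranched E (D.src a), a = ch ⟨D.src a, Or.inl hb⟩
    with hsel
  have hnx : ∀ v, ¬ D.DeadEnd E v → ∃ a ∈ E, D.src a = v ∧ sel a := by
    intro v hv
    by_cases hb : D.Unbranched E v
    · unfold DeadEnd at hv
      push Not at hv
      obtain ⟨a, ha, rfl⟩ := hv
      exact ⟨a, ha, rfl, fun hb' => absurd hb hb'⟩
    · have h1 : ¬ D.IsEnd E v := fun h => hv h.1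
      obtain ⟨h2, h3⟩ := hch1 ⟨v, Or.inl hb⟩ h1
      refine ⟨_, h2, h3, fun hb' => ?_⟩
      congr 1
      exact Subtype.ext h3.symm
  have hpf := fun v => exists_path_flow hρ hnx _ v rfl
  choose F z hz hz' hzr hF0 hF hFnet using hpf
  set b : {w // D.IsEnd E w} → A := fun w => ch ⟨w, Or.inr w.2⟩ with hb
  have hbe : ∀ w, D.IsEntry E w.1 (b w) := fun w => hch2 _ w.2
  -- The tail of an entry is branched and the choices are distinct, so the entry chosen for `w` is
  -- not the arc selected at its tail.
  have hbsel : ∀ w, ¬ sel (b w) := by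
    intro w hs
    have h1 := hs (hbe w).branched
    have h2 := congrArg Subtype.val (hinj h1)
    exact w.2.1 _ (hbe w).1 h2.symm
  have hφ : ∀ w, D.IsEnd E (z (D.src (b w))) := by
    intro w
    rcases hz' (D.src (b w)) with h1 | h1
    · exact absurd rfl (hz (D.src (b w)) (b w) (hbe w).1 <| h1 ▸ ·)
    · exact h1
  set φ : {w // D.IsEnd E w} → {w // D.IsEnd E w} := fun w => ⟨z (D.src (b w)), hφ w⟩ with hφdef
  have hzb : ∀ w, z (D.tgt (b w)) = w.1 := fun w =>
    (hbe w).2.2.1.end_unique (hzr _) (hbe w).2.2.2 (hz _) w.2.1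
  set Z : Finset {w // D.IsEnd E w} := Finset.univ.filter (· ∈ Function.periodicPts φ) with hZ
  -- For every `w` on a cycle of `φ`, one unit is rerouted at the tail of `b w`: instead of
  -- following selected arcs to the end `φ w`, it takes `b w` and proceeds to `w`. Each end on a
  -- cycle gains one unit and loses one.
  set δ : A → ℝ := fun a => ∑ w ∈ Z,
    (((if a = b w then 1 else 0) + F (D.tgt (b w)) a) - F (D.src (b w)) a) with hδ
  have hnet : ∀ v, D.net δ v = 0 := by
    intro v
    rw [hδ, net_sum]
    have h1 := sum_periodicPts_sub φ fun w => if w.1 = v then (1 : ℝ) else 0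
    refine Eq.trans (Finset.sum_congr rfl fun w _ => ?_) h1
    rw [net_sub, net_add, net_single, hFnet, hFnet, hzb]
    ring
  have hsupp : ∀ a, δ a ≠ 0 → a ∈ E := by
    intro a ha
    by_contra haE
    refine ha (Finset.sum_eq_zero fun w _ => ?_)
    have h1 : F (D.tgt (b w)) a = 0 := by
      by_contra h; exact haE (hF _ _ h).1
    have h2 : F (D.src (b w)) a = 0 := by
      by_contra h; exact haE (hF _ _ h).1
    rw [h1, h2, if_neg]
    · ring
    · rintro rfl; exact haE (hbe w).1
  have hirr : ∀ a, ¬ D.Regular E (D.tgt a) → δ a ≤ 0 := by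
    intro a ha
    refine Finset.sum_nonpos fun w _ => ?_
    have h1 : F (D.tgt (b w)) a = 0 := by
      by_contra h
      obtain ⟨h2, -, h3⟩ := hF _ _ h
      exact ha ((hbe w).2.2.1.of_reach (h3.trans (reach_arc h2)))
    rw [h1, if_neg]
    · linarith [hF0 (D.src (b w)) a]
    · rintro rfl; exact ha (hbe w).2.2.1
  obtain ⟨e, he, hemax⟩ := Finset.exists_max_image (Finset.univ.filter (· ∈ E))
    (fun a => ρ (D.tgt a)) (by obtain ⟨a, ha⟩ := hE; exact ⟨a, by simpa using ha⟩)
  simp only [Finset.mem_filter, Finset.mem_univ, true_and] at he hemax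
  have hend : D.IsEnd E (D.tgt e) := ⟨fun a ha hs => by
    have h1 := hemax a ha
    have h2 := hρ a ha
    rw [hs] at h2; omega, e, he, rfl⟩
  have : Nonempty {w // D.IsEnd E w} := ⟨⟨_, hend⟩⟩
  obtain ⟨w, hw⟩ := exists_mem_periodicPts φ
  -- The subtracted paths use selected arcs only and hence avoid `b w`.
  have hpos : 0 < δ (b w) := by
    refine lt_of_lt_of_le zero_lt_one ?_
    have hterm : ∀ w', 0 ≤ (((if b w = b w' then (1 : ℝ) else 0) + F (D.tgt (b w')) (b w)) -
        F (D.src (b w')) (b w)) ∧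
        (w' = w → 1 ≤ (((if b w = b w' then (1 : ℝ) else 0) + F (D.tgt (b w')) (b w)) -
        F (D.src (b w')) (b w))) := by
      intro w'
      have h1 : F (D.src (b w')) (b w) = 0 := by
        by_contra h; exact hbsel w (hF _ _ h).2.1
      have h2 := hF0 (D.tgt (b w')) (b w)
      rw [h1]
      constructor
      · split_ifs <;> linarith
      · rintro rfl; rw [if_pos rfl]; linarith
    exact ((hterm w).2 rfl).trans
      (Finset.single_le_sum (f := fun w' => (((if b w = b w' then (1 : ℝ) else 0) +
        F (D.tgt (b w')) (b w)) - F (D.src (b w')) (b w))) (fun w' _ => (hterm w').1)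
        (by simpa [hZ] using hw))
  refine ⟨δ, hnet, hsupp, hirr, ?_⟩
  -- A nonnegative, nonzero circulation is impossible on arcs along which the rank increases.
  by_contra! hneg
  have h1 := D.sum_mul_net (fun v => (ρ v : ℝ)) δ
  simp only [hnet, mul_zero, Finset.sum_const_zero] at h1
  have h2 : ∑ a, δ a * ((ρ (D.src a) : ℝ) - ρ (D.tgt a)) < 0 := by
    refine Finset.sum_neg' (fun a _ => ?_) ⟨b w, Finset.mem_univ _, ?_⟩
    · by_cases h3 : δ a = 0
      · simp [h3]
      · have h4 : (ρ (D.src a) : ℝ) < ρ (D.tgt a) := by exact_mod_cast hρ a (hsupp a h3)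
        exact mul_nonpos_of_nonneg_of_nonpos (hneg a) (by linarith)
    · have h4 : (ρ (D.src (b w)) : ℝ) < ρ (D.tgt (b w)) := by exact_mod_cast hρ _ (hbe w).1
      exact mul_neg_of_pos_of_neg hpos (by linarith)
  linarith

/-- The largest step that satisfies finitely many linear constraints. -/
theorem exists_max_step {ι : Type*} [Fintype ι] (c k : ι → ℝ) (hc : ∀ i, 0 ≤ c i)
    (hck : ∀ i, 0 < k i → 0 < c i) (hk : ∃ i, 0 < k i) :
    ∃ ε, 0 < ε ∧ (∀ i, ε * k i ≤ c i) ∧ ∃ i, 0 < k i ∧ ε * k i = c i := by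
  classical
  obtain ⟨j, hj⟩ := hk
  obtain ⟨i, hi, hmin⟩ := Finset.exists_min_image (Finset.univ.filter fun i => 0 < k i)
    (fun i => c i / k i) ⟨j, by simpa using hj⟩
  simp only [Finset.mem_filter, Finset.mem_univ, true_and] at hi hmin
  have hε : 0 < c i / k i := div_pos (hck i hi) hi
  refine ⟨c i / k i, hε, fun l => ?_, i, hi, div_mul_cancel₀ _ hi.ne'⟩
  by_cases hl : 0 < k l
  · exact (le_div_iff₀ hl).1 (hmin l hl)
  · exact (mul_nonpos_of_nonneg_of_nonpos hε.le (not_lt.1 hl)).trans (hc l)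

end Augment

/-! ### Augmenting, and termination of the rounding procedure -/

section Main

set_option linter.unusedSectionVars false

variable {V A S T : Type*} [Fintype V] [Fintype A] [Fintype S] [Fintype T] [DecidableEq V]
  {D : ArcDigraph V A} {ρ : V → ℕ} {lab : A → Bool} {σ : FlowState V A S T}

/-- Augment the flow by `g`, all arcs leading to regular vertices becoming closed. -/
def FlowState.augment (D : ArcDigraph V A) (σ : FlowState V A S T) (g : A → ℝ) :
    FlowState V A S T where
  flow a := σ.flow a + g a
  srcPos := σ.srcPos
  supply := σ.supply
  snkPos := σ.snkPos
  demand := σ.demand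
  closed := {a | a ∈ σ.closed ∨ (a ∈ σ.alive ∧ D.Regular σ.alive (D.tgt a))}
  moved := σ.moved

/-- No sink can be moved backwards. -/
def FlowState.Blocked (D : ArcDigraph V A) (σ : FlowState V A S T) : Prop :=
  ∀ t a, 0 < σ.demand t → σ.snkPos t = D.tgt a → a ∈ σ.alive →
    (a ∉ σ.closed → σ.flow a < σ.demand t) ∧ (a ∈ σ.closed → σ.flow a ≠ σ.demand t)

/-- Regularity of the head gives the structural invariants of a newly closed arc. For
`closed_demand`, `Blocked` makes the relevant inequalities between flow and demand strict before the
augmentation, and `hle` prevents the flow from overtaking the demand. -/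
theorem FlowState.Valid.augment (hv : σ.Valid D ρ) (hb : σ.Blocked D) {g : A → ℝ}
    (hnet : ∀ v, D.net g v = 0) (hsupp : ∀ a, g a ≠ 0 → a ∈ σ.alive)
    (hnonneg : ∀ a, 0 ≤ σ.flow a + g a)
    (hle : ∀ a t, σ.snkPos t = D.tgt a → σ.flow a < σ.demand t → σ.flow a + g a ≤ σ.demand t) :
    (σ.augment D g).Valid D ρ := by
  have hal : (σ.augment D g).alive ⊆ σ.alive := by
    intro a ha
    by_cases hg : g a = 0
    · simpa [FlowState.alive, FlowState.augment, hg] using ha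
    · exact hsupp a hg
  refine ⟨hnonneg, hv.supply_nonneg, hv.demand_nonneg, fun v => ?_,
    fun a ha => hv.rank a (hal ha), fun a hc ha => ?_, fun a hc ha a' ha' hs => ?_,
    fun a hc ha => ?_, hv.unmoved_out, hv.unmoved_alone⟩
  · simp only [FlowState.augment]
    rw [net_add, hnet, add_zero]; exact hv.balance v
  · rcases hc with hc | hc
    · exact (hv.closed_unbranched a hc (hal ha)).mono hal
    · exact (hc.2 _ (Reach.refl _ _)).mono hal
  · rcases hc with hc | hc
    · exact Or.inl (hv.closed_succ a hc (hal ha) a' (hal ha') hs)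
    · refine Or.inr ⟨hal ha', Regular.of_reach hc.2 ?_⟩
      rw [← hs]; exact reach_arc (hal ha')
  · by_cases hc' : a ∈ σ.closed
    · have key : ∀ t, 0 < σ.demand t → σ.snkPos t = D.tgt a → σ.flow a ≤ σ.demand t →
          σ.flow a + g a ≤ σ.demand t := fun t hd ht hf =>
        hle a t ht (lt_of_le_of_ne hf ((hb t a hd ht (hal ha)).2 hc'))
      rcases hv.closed_demand a hc' (hal ha) with h1 | ⟨h1, t₀, h2⟩
      · exact Or.inl fun t hd ht => key t hd ht (h1 t hd ht)
      · exact Or.inr ⟨h1.mono hal, t₀, fun t hne hd ht => key t hd ht (h2 t hne hd ht)⟩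
    · exact Or.inl fun t hd ht => hle a t ht ((hb t a hd ht (hal ha)).1 hc')

/-- `cap` does not increase anywhere: an arc that gains flow has a regular head, so it becomes
closed. -/
theorem FlowState.routable_of_augment (hv : σ.Valid D ρ) {g : A → ℝ}
    (hsupp : ∀ a, g a ≠ 0 → a ∈ σ.alive)
    (hirr : ∀ a, ¬ D.Regular σ.alive (D.tgt a) → g a ≤ 0)
    (hr : (σ.augment D g).Routable D lab) : σ.Routable D lab := by
  classical
  obtain ⟨m, path, lay, q, hr⟩ := hr
  refine ⟨m, path, lay, q, hr.nonneg, hr.row, hr.col, hr.walk, fun s t hst a ha => ?_, hr.q_moved,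
    hr.load_le_q, hr.load_le_sub, fun e β hβ => (hr.own e β hβ).trans ?_, hr.foreign⟩
  · have h1 := hr.walk_alive s t hst a ha
    by_cases hg : g a = 0
    · simpa [FlowState.alive, FlowState.augment, hg] using h1
    · exact hsupp a hg
  · have h0 := hv.cap_nonneg e
    have : (σ.augment D g).cap e ≤ σ.cap e := by
      by_cases h1 : e ∈ (σ.augment D g).closed
      · rw [FlowState.cap, if_pos h1]; exact h0
      · have h2 : e ∉ σ.closed := fun h => h1 (Or.inl h)
        rw [FlowState.cap, FlowState.cap, if_neg h1, if_neg h2]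
        simp only [FlowState.augment]
        by_cases hg : g e = 0
        · simp [hg]
        · have := hirr e fun hreg => h1 (Or.inr ⟨hsupp e hg, hreg⟩)
          linarith
    linarith

/-- The rounding procedure: a valid state can be routed unsplittably. -/
theorem FlowState.Valid.routable (hlab : ∀ a a', D.tgt a = D.src a' → lab a = lab a')
    (hv : σ.Valid D ρ) : σ.Routable D lab := by
  classical
  induction hn : σ.size ρ using Nat.strong_induction_on generalizing σ with
  | _ n ih =>
  subst hn
  have ih' : ∀ σ' : FlowState V A S T, σ'.Valid D ρ → σ'.size ρ < σ.size ρ →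
      σ'.Routable D lab := fun σ' hv' hlt => ih _ hlt hv' rfl
  by_cases hne : σ.alive.Nonempty
  swap
  · refine hv.routable_of_flow_eq_zero fun a => le_antisymm (not_lt.1 fun ha => hne ⟨a, ha⟩)
      (hv.flow_nonneg a)
  by_cases hb : σ.Blocked D
  swap
  · unfold FlowState.Blocked at hb
    push Not at hb
    obtain ⟨t, a, hd, ht, ha, h1⟩ := hb
    have h2 : σ.demand t ≤ σ.flow a ∧ (a ∈ σ.closed → σ.flow a = σ.demand t) := by
      by_cases hc : a ∈ σ.closed
      · by_cases h3 : σ.flow a = σ.demand t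
        · exact ⟨h3.ge, fun _ => h3⟩
        · exact absurd (h1 fun h => absurd hc h).2 h3
      · refine ⟨?_, fun h => absurd h hc⟩
        by_contra hlt
        exact hc (h1 fun _ => not_le.1 hlt).1
    exact FlowState.routable_of_moveSink hlab hv hd ht h2.1 h2.2
      (ih' _ (hv.moveSink hd ht h2.1 h2.2) (FlowState.size_moveSink_lt hv hd ht h2.1))
  by_cases hent : ∀ w, D.IsEnd σ.alive w →
      ∃ a a', a ≠ a' ∧ D.IsEntry σ.alive w a ∧ D.IsEntry σ.alive w a'
  swap
  · push Not at hent
    obtain ⟨w, hw, hent⟩ := hent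
    obtain ⟨X, q, hX⟩ := exists_isTree hw fun a a' ha ha' => by
      by_contra h; exact hent a a' h ha ha'
    obtain ⟨m₀, hp⟩ := hX.exists_plan hv
    exact hX.routable_of_contract hlab hv hp
      (ih' _ (hX.contract_valid hv hp) (hX.size_contract_lt hv hp))
  obtain ⟨δ, hnet, hsupp, hirr, a₀, ha₀⟩ := exists_augmenting hv.rank hne hent
  -- The step is limited by two kinds of constraints: no flow becomes negative, and no flow
  -- overtakes a larger demand located at the head of its arc.
  set cond : A × T → Prop := fun p => σ.snkPos p.2 = D.tgt p.1 ∧ σ.flow p.1 < σ.demand p.2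
    with hcond
  set c : A ⊕ A × T → ℝ := Sum.elim σ.flow
    (fun p => if cond p then σ.demand p.2 - σ.flow p.1 else 0) with hc
  set k : A ⊕ A × T → ℝ := Sum.elim (fun a => - δ a) (fun p => if cond p then δ p.1 else 0)
    with hk
  obtain ⟨ε, hε, hεle, i, hi, hieq⟩ := exists_max_step c k
    (fun i => by
      rcases i with a | p
      · exact hv.flow_nonneg a
      · simp only [hc, Sum.elim_inr]
        split_ifs with h
        · linarith [h.2]
        · exact le_rfl)
    (fun i hi => by
      rcases i with a | p
      · refine hsupp a ?_
        simp only [hk, Sum.elim_inl] at hi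
        linarith
      · simp only [hc, hk, Sum.elim_inr] at hi ⊢
        split_ifs at hi ⊢ with h
        · linarith [h.2]
        · exact absurd hi (lt_irrefl _))
    ⟨Sum.inl a₀, by simpa [hk] using ha₀⟩
  set g : A → ℝ := fun a => ε * δ a with hg
  have hgsupp : ∀ a, g a ≠ 0 → a ∈ σ.alive := fun a ha => hsupp a (right_ne_zero_of_mul ha)
  have hgnonneg : ∀ a, 0 ≤ σ.flow a + g a := fun a => by
    have := hεle (Sum.inl a)
    simp only [hc, hk, Sum.elim_inl] at this
    simp only [hg]; linarith
  have hgirr : ∀ a, ¬ D.Regular σ.alive (D.tgt a) → g a ≤ 0 := fun a ha =>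
    mul_nonpos_of_nonneg_of_nonpos hε.le (hirr a ha)
  have hv' : (σ.augment D g).Valid D ρ := hv.augment hb
    (fun v => by rw [hg, net_smul, hnet, mul_zero]) hgsupp hgnonneg (fun a t ht hlt => by
      have h1 : cond (a, t) := ⟨ht, hlt⟩
      have h2 := hεle (Sum.inr (a, t))
      simp only [hc, hk, Sum.elim_inr, if_pos h1] at h2
      simp only [hg]; linarith)
  refine FlowState.routable_of_augment hv hgsupp hgirr ?_
  have hal : ∀ a, 0 < (σ.augment D g).flow a → 0 < σ.flow a := by
    intro a ha
    by_cases hga : g a = 0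
    · simpa [FlowState.augment, hga] using ha
    · exact hgsupp a hga
  -- If the tight constraint is a vanishing flow, the number of alive arcs drops. If it is a demand,
  -- augmenting need not decrease the size, so the sink concerned is moved at once.
  rcases i with a | ⟨a, t⟩
  · refine ih' _ hv' ?_
    have h1 := card_filter_lt_card_filter (P := fun a => 0 < (σ.augment D g).flow a)
      (Q := fun a => 0 < σ.flow a) hal ⟨a, hsupp a (by
        simp only [hk, Sum.elim_inl] at hi
        linarith), by
        simp only [hc, hk, Sum.elim_inl] at hieq
        simp only [FlowState.augment, hg]; linarith⟩
    unfold FlowState.size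
    exact Nat.add_lt_add_right h1 _
  · simp only [hc, hk, Sum.elim_inr] at hi hieq
    by_cases h1 : cond (a, t)
    swap
    · rw [if_neg h1] at hi; exact absurd hi (lt_irrefl _)
    simp only [if_pos h1] at hi hieq
    have hfa : (σ.augment D g).flow a = σ.demand t := by
      simp only [FlowState.augment, hg]; linarith
    have hd : 0 < (σ.augment D g).demand t := lt_of_le_of_lt (hv.flow_nonneg a) h1.2
    have ht : (σ.augment D g).snkPos t = D.tgt a := h1.1
    have hle : (σ.augment D g).demand t ≤ (σ.augment D g).flow a := hfa.ge
    have h2 := card_filter_le_card_filter (P := fun a => 0 < (σ.augment D g).flow a)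
      (Q := fun a => 0 < σ.flow a) hal
    have h3 : (σ.augment D g).size ρ ≤ σ.size ρ := by
      unfold FlowState.size
      exact Nat.add_le_add_right h2 _
    exact FlowState.routable_of_moveSink hlab hv' hd ht hle (fun _ => hfa)
      (ih' _ (hv'.moveSink hd ht hle fun _ => hfa)
        ((FlowState.size_moveSink_lt hv' hd ht hle).trans_le h3))

end Main

/-! ### Cancelling directed cycles -/

section Acyclic

set_option linter.unusedSectionVars false

variable {V A : Type*} [Fintype A] [DecidableEq V] {D : ArcDigraph V A}

theorem IsWalk.net_count [DecidableEq A] {u v : V} {p : List A} (h : D.IsWalk u v p) (x : V) :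
    D.net (fun a => (p.count a : ℝ)) x = (if u = x then 1 else 0) - if v = x then 1 else 0 := by
  induction p generalizing u with
  | nil => cases h; simp [net]
  | cons e p ih =>
    obtain ⟨rfl, h2⟩ := h
    have h1 : (fun a => ((e :: p).count a : ℝ)) =
        fun a => (p.count a : ℝ) + if a = e then 1 else 0 := by
      funext a
      by_cases h : a = e
      · simp [h]
      · simp [h, Ne.symm h]
    rw [h1, net_add, net_single, ih h2]; ring

open scoped Classical in
/-- Every flow contains a flow with the same balances whose support is acyclic. -/
theorem exists_acyclic_le (D : ArcDigraph V A) :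
    ∀ (n : ℕ) (x : A → ℝ), (∀ a, 0 ≤ x a) →
    (Finset.univ.filter fun a => 0 < x a).card = n →
    ∃ (y : A → ℝ) (ρ : V → ℕ), (∀ a, 0 ≤ y a) ∧ (∀ a, y a ≤ x a) ∧
      (∀ v, D.net y v = D.net x v) ∧ ∀ a, 0 < y a → ρ (D.src a) < ρ (D.tgt a) := by
  intro n
  induction n using Nat.strong_induction_on with
  | _ n ih =>
  intro x hx hn
  set E : Set A := {a | 0 < x a} with hE
  by_cases hcyc : ∃ a ∈ E, D.Reach E (D.tgt a) (D.src a)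
  · obtain ⟨a, ha, hr⟩ := hcyc
    obtain ⟨p, hp, hpE⟩ := hr.exists_isWalk
    have hw : D.IsWalk (D.src a) (D.src a) (a :: p) := ⟨rfl, hp⟩
    have hmem : ∀ b ∈ a :: p, 0 < x b := by
      intro b hb
      rcases List.mem_cons.1 hb with rfl | hb
      · exact ha
      · exact (hpE b hb).1
    -- Flow is removed along the closed walk, with multiplicities, until one of its arcs dies.
    obtain ⟨ε, hε, hle, i, hi, hieq⟩ := exists_max_step x
      (fun b => ((a :: p).count b : ℝ)) hx
      (fun b hb => hmem b (List.count_pos_iff.1 (by exact_mod_cast hb)))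
      ⟨a, by exact_mod_cast List.count_pos_iff.2 (by simp)⟩
    set y : A → ℝ := fun b => x b - ε * ((a :: p).count b : ℝ) with hy
    have hyx : ∀ b, y b ≤ x b := fun b => sub_le_self _ (by positivity)
    have hlt := card_filter_lt_card_filter (P := fun b => 0 < y b) (Q := fun b => 0 < x b)
      (fun b hb => lt_of_lt_of_le hb (hyx b))
      ⟨i, hmem i (List.count_pos_iff.1 (by exact_mod_cast hi)), by simp only [hy]; linarith⟩
    obtain ⟨z, ρ, h1, h2, h3, h4⟩ := ih _ (hn ▸ hlt) y
      (fun b => by have := hle b; simp only [hy]; linarith) rfl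
    refine ⟨z, ρ, h1, fun b => (h2 b).trans (hyx b), fun v => ?_, h4⟩
    rw [h3, hy, net_sub, net_smul, hw.net_count]; simp
  · push Not at hcyc
    -- The rank of `v` counts the alive arcs from whose heads `v` can be reached. Without cycles, an
    -- alive arc `a` is counted at its head but not at its tail.
    refine ⟨x, fun v => (Finset.univ.filter fun b => b ∈ E ∧ D.Reach E (D.tgt b) v).card, hx,
      fun _ => le_rfl, fun _ => rfl, fun a ha => ?_⟩
    have hlt := card_filter_lt_card_filter (P := fun b => b ∈ E ∧ D.Reach E (D.tgt b) (D.src a))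
      (Q := fun b => b ∈ E ∧ D.Reach E (D.tgt b) (D.tgt a))
      (fun b hb => ⟨hb.1, hb.2.trans (reach_arc ha)⟩) ⟨a, ⟨ha, Reach.refl _ _⟩,
        fun h => hcyc a ha h.2⟩
    dsimp only
    convert hlt

end Acyclic

/-! ### The two layers -/

section Layered

set_option linter.unusedSectionVars false

variable {V A : Type*} [Fintype V] [Fintype A] [DecidableEq V]

/-- Two copies of a digraph together with a new source and a new sink for every vertex. -/
def layered (D : ArcDigraph V A) :
    ArcDigraph ((V × Bool) ⊕ V ⊕ V) ((A × Bool) ⊕ (V × Bool) ⊕ (V × Bool)) where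
  src := Sum.elim (fun p => Sum.inl (D.src p.1, p.2))
    (Sum.elim (fun p => Sum.inr (Sum.inl p.1)) (fun p => Sum.inl p))
  tgt := Sum.elim (fun p => Sum.inl (D.tgt p.1, p.2))
    (Sum.elim (fun p => Sum.inl p) (fun p => Sum.inr (Sum.inr p.1)))

/-- The layer of an arc. -/
def layerOf : (A × Bool) ⊕ (V × Bool) ⊕ (V × Bool) → Bool :=
  Sum.elim Prod.snd (Sum.elim Prod.snd Prod.snd)

/-- No arc enters a new source or leaves a new sink, so consecutive arcs meet in a copy of an
original vertex, which belongs to one layer. -/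
theorem layered_layerOf (D : ArcDigraph V A) (a a') (h : D.layered.tgt a = D.layered.src a') :
    layerOf (V := V) (A := A) a = layerOf a' := by
  rcases a with ⟨a, i⟩ | ⟨u, i⟩ | ⟨u, i⟩ <;> rcases a' with ⟨a', j⟩ | ⟨w, j⟩ | ⟨w, j⟩ <;>
    simp_all [layered, layerOf]

/-- The initial state: half of the flow in either layer. -/
noncomputable def layeredState (b : V → ℝ) (x : A → ℝ) :
    FlowState ((V × Bool) ⊕ V ⊕ V) ((A × Bool) ⊕ (V × Bool) ⊕ (V × Bool)) V V where
  flow := Sum.elim (fun p => x p.1 / 2)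
    (Sum.elim (fun p => max (b p.1) 0 / 2) (fun p => max (-b p.1) 0 / 2))
  srcPos v := Sum.inr (Sum.inl v)
  supply v := max (b v) 0
  snkPos v := Sum.inr (Sum.inr v)
  demand v := max (-b v) 0
  closed := ∅
  moved := ∅

/-- New sources have rank 0, copied vertices are shifted by one, and new sinks come last. Nothing is
closed yet, and the new sinks occupy distinct vertices that no arc leaves. -/
theorem layeredState_valid {D : ArcDigraph V A} {b : V → ℝ} {x : A → ℝ} {ρ : V → ℕ}
    (hx : ∀ a, 0 ≤ x a) (hnet : ∀ v, D.net x v = b v)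
    (hρ : ∀ a, 0 < x a → ρ (D.src a) < ρ (D.tgt a)) :
    (layeredState b x).Valid D.layered (Sum.elim (fun p => ρ p.1 + 1)
      (Sum.elim (fun _ => 0) (fun _ => Finset.univ.sup ρ + 2))) := by
  have hb : ∀ v, max (b v) 0 - max (-b v) 0 = b v := fun v => by
    rcases le_total (b v) 0 with h | h
    · rw [max_eq_right h, max_eq_left (by linarith)]; ring
    · rw [max_eq_left h, max_eq_right (by linarith)]; ring
  refine ⟨?_, fun s => le_max_right _ _, fun t => le_max_right _ _, ?_, ?_,
    fun a ha => absurd ha (by simp [layeredState]), fun a ha => absurd ha (by simp [layeredState]),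
    fun a ha => absurd ha (by simp [layeredState]), ?_, ?_⟩
  · rintro (⟨a, i⟩ | ⟨u, i⟩ | ⟨u, i⟩)
    · exact div_nonneg (hx a) (by norm_num)
    · exact div_nonneg (le_max_right _ _) (by norm_num)
    · exact div_nonneg (le_max_right _ _) (by norm_num)
  · rintro (⟨v, i⟩ | v | v)
    · have h1 : D.layered.net (layeredState b x).flow (Sum.inl (v, i)) =
          D.net x v / 2 - max (b v) 0 / 2 + max (-b v) 0 / 2 := by
        unfold net
        rw [Fintype.sum_sum_type, Fintype.sum_sum_type, Fintype.sum_prod_type, Finset.sum_div]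
        cases i <;> simp [layered, layeredState, sub_div, ite_div] <;> ring
      rw [h1, hnet, massAt_eq_zero, massAt_eq_zero]
      · linarith [hb v]
      · simp [layeredState]
      · simp [layeredState]
    · have h1 : D.layered.net (layeredState b x).flow (Sum.inr (Sum.inl v)) = max (b v) 0 := by
        unfold net
        rw [Fintype.sum_sum_type, Fintype.sum_sum_type]
        simp [layered, layeredState, Fintype.sum_prod_type]
        ring
      rw [h1, massAt_eq_zero (p := (layeredState b x).snkPos) (by simp [layeredState])]
      simp [massAt, layeredState]
    · have h1 : D.layered.net (layeredState b x).flow (Sum.inr (Sum.inr v)) =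
          - max (-b v) 0 := by
        unfold net
        rw [Fintype.sum_sum_type, Fintype.sum_sum_type]
        simp [layered, layeredState, Fintype.sum_prod_type]
        ring
      rw [h1, massAt_eq_zero (p := (layeredState b x).srcPos) (by simp [layeredState])]
      simp [massAt, layeredState]
  · rintro (⟨a, i⟩ | ⟨u, i⟩ | ⟨u, i⟩) ha
    · have h1 : 0 < x a := by
        have : 0 < x a / 2 := ha
        linarith
      simpa [layered] using hρ a h1
    · simp [layered]
    · have h1 : ρ u ≤ Finset.univ.sup ρ := Finset.le_sup (Finset.mem_univ _)
      simp only [layered, Sum.elim_inl, Sum.elim_inr]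
      omega
  · rintro t - (⟨a, i⟩ | ⟨u, i⟩ | ⟨u, i⟩) <;> simp [layered, layeredState]
  · intro t _ t' _ h
    simpa [layeredState] using h

/-- The arc of the original digraph underlying an arc of the layered digraph. -/
def baseArc : (A × Bool) ⊕ (V × Bool) ⊕ (V × Bool) → Option A :=
  Sum.elim (fun p => some p.1) (fun _ => none)

theorem isWalk_base_of_inl {D : ArcDigraph V A} {t : V} :
    ∀ {p : List ((A × Bool) ⊕ (V × Bool) ⊕ (V × Bool))} {v : V} {i : Bool},
      D.layered.IsWalk (Sum.inl (v, i)) (Sum.inr (Sum.inr t)) p →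
      D.IsWalk v t (p.filterMap baseArc) := by
  intro p
  induction p with
  | nil => intro v i h; cases h
  | cons e p ih =>
    intro v i h
    obtain ⟨h1, h2⟩ := h
    rcases e with ⟨a, j⟩ | ⟨u, j⟩ | ⟨u, j⟩
    · simp only [layered, Sum.elim_inl, Sum.inl.injEq, Prod.mk.injEq] at h1
      exact ⟨h1.1, ih (i := j) h2⟩
    · simp [layered] at h1
    · simp only [layered, Sum.elim_inr, Sum.inl.injEq, Prod.mk.injEq] at h1
      cases p with
      | nil =>
        have h3 : (Sum.inr (Sum.inr u) : (V × Bool) ⊕ V ⊕ V) = Sum.inr (Sum.inr t) := h2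
        simp only [Sum.inr.injEq] at h3
        exact h1.1.symm.trans h3
      | cons e' p =>
        have h3 : D.layered.src e' = Sum.inr (Sum.inr u) := h2.1
        rcases e' with ⟨a, j⟩ | ⟨u, j⟩ | ⟨u, j⟩ <;> simp [layered] at h3

theorem isWalk_base {D : ArcDigraph V A} {s t : V}
    {p : List ((A × Bool) ⊕ (V × Bool) ⊕ (V × Bool))}
    (h : D.layered.IsWalk (Sum.inr (Sum.inl s)) (Sum.inr (Sum.inr t)) p) :
    D.IsWalk s t (p.filterMap baseArc) := by
  cases p with
  | nil => cases h
  | cons e p =>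
    obtain ⟨h1, h2⟩ := h
    rcases e with ⟨a, j⟩ | ⟨u, j⟩ | ⟨u, j⟩
    · simp [layered] at h1
    · simp only [layered, Sum.elim_inl, Sum.elim_inr, Sum.inr.injEq, Sum.inl.injEq] at h1
      subst h1
      exact (isWalk_base_of_inl (p := p) (v := u) (i := j) h2 :)
    · simp [layered] at h1

open scoped Classical in
theorem sum_le_of_subsingleton {T : Type*} [Fintype T] {P : T → Prop} {L : T → ℝ} {γ : ℝ}
    (hγ : 0 ≤ γ) (hle : ∀ t, P t → L t ≤ γ) (hL : ∀ t, 0 ≤ L t)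
    (huniq : ∀ t t', P t → P t' → 0 < L t → 0 < L t' → t = t') :
    ∑ t, (if P t then L t else 0) ≤ γ := by
  by_cases h : ∃ t, P t ∧ 0 < L t
  · obtain ⟨t₀, h0, h0'⟩ := h
    rw [Finset.sum_eq_single t₀]
    · rw [if_pos h0]; exact hle t₀ h0
    · intro t _ hne
      split_ifs with ht
      · by_contra hz
        exact hne (huniq t t₀ ht h0 (lt_of_le_of_ne (hL t) (Ne.symm hz)) h0')
      · rfl
    · simp
  · push Not at h
    refine le_trans (Finset.sum_nonpos fun t _ => ?_) hγ
    split_ifs with ht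
    · exact h t ht
    · exact le_rfl

open scoped Classical in
/-- An unsplittable routing in which every sink is assigned to one of two classes such that every
class uses little more than half of the flow. -/
theorem exists_two_class_routing {D : ArcDigraph V A} {b : V → ℝ} {x : A → ℝ} {ρ : V → ℕ}
    (hx : ∀ a, 0 ≤ x a) (hnet : ∀ v, D.net x v = b v)
    (hρ : ∀ a, 0 < x a → ρ (D.src a) < ρ (D.tgt a)) :
    ∃ (m : V → V → ℝ) (path : V → V → List A) (lay : V → Bool) (q : V → ℝ),
      (∀ s t, 0 ≤ m s t) ∧ (∀ s, ∑ t, m s t = max (b s) 0) ∧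
      (∀ t, ∑ s, m s t = max (-b t) 0) ∧
      (∀ s t, 0 < m s t → D.IsWalk s t (path s t) ∧
        ∀ a ∈ path s t, ρ (D.src a) < ρ (D.tgt a)) ∧
      (∀ t, 0 ≤ q t ∧ q t ≤ max (-b t) 0) ∧
      ∀ (P : V → Prop) (i : Bool) (β γ : ℝ) (a : A), 0 ≤ β → 0 ≤ γ →
        (∀ t, P t → lay t = i ∧ q t ≤ β ∧ max (-b t) 0 - q t ≤ γ) →
        ∑ t, (if P t then arcLoad m path a t else 0) ≤ x a / 2 + β + γ := by
  obtain ⟨m, path, lay, q, hr⟩ := (layeredState_valid hx hnet hρ).routable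
    (lab := layerOf) D.layered_layerOf
  have hnm : ∀ t, t ∉ (layeredState b x).moved := fun t h => h
  have hown : ∀ e t, (layeredState b x).Own layerOf lay e t ↔ layerOf e = lay t := fun e t =>
    ⟨fun h => h.resolve_left (hnm t), Or.inr⟩
  set path' : V → V → List A := fun s t => (path s t).filterMap baseArc with hpath'
  have hmem : ∀ a s t, a ∈ path' s t ↔ ∃ i, Sum.inl (a, i) ∈ path s t := by
    intro a s t
    simp only [hpath', List.mem_filterMap]
    constructor
    · rintro ⟨⟨a', i⟩ | e, he, h⟩
      · simp only [baseArc, Sum.elim_inl, Option.some.injEq] at h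
        exact ⟨i, h ▸ he⟩
      · simp [baseArc] at h
    · rintro ⟨i, hi⟩
      exact ⟨_, hi, rfl⟩
  have hload : ∀ a (i : Bool) t, arcLoad m path' a t ≤
      arcLoad m path (Sum.inl (a, i)) t + arcLoad m path (Sum.inl (a, !i)) t := by
    intro a i t
    rw [arcLoad, arcLoad, arcLoad, ← Finset.sum_add_distrib]
    refine Finset.sum_le_sum fun s _ => ?_
    have h0 := hr.nonneg s t
    by_cases h : a ∈ path' s t
    · obtain ⟨j, hj⟩ := (hmem a s t).1 h
      rw [if_pos h]
      rcases Bool.eq_or_eq_not j i with rfl | rfl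
      · rw [if_pos hj]; split_ifs <;> linarith
      · rw [if_pos (c := _ ∈ _) hj]; split_ifs <;> linarith
    · rw [if_neg h]; split_ifs <;> linarith
  refine ⟨m, path', lay, q, hr.nonneg, hr.row, hr.col, fun s t hst => ⟨isWalk_base (hr.walk s t hst),
    fun a ha => ?_⟩, fun t => ⟨?_, ?_⟩, fun P i β γ a hβ hγ hP => ?_⟩
  · obtain ⟨i, hi⟩ := (hmem a s t).1 ha
    have h1 : 0 < x a / 2 := hr.walk_alive s t hst _ hi
    exact hρ a (by linarith)
  -- The two arcs into the new sink of `t`, one in each layer, only serve as test arcs: loads are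
  -- nonnegative, which bounds `q t` on both sides.
  · exact (arcLoad_nonneg hr.nonneg path _ t).trans
      (hr.load_le_q t (hnm t) (Sum.inr (Sum.inl (t, lay t))) rfl)
  · have h1 := hr.load_le_sub t (hnm t) (Sum.inr (Sum.inl (t, !lay t))) (by simp [layerOf])
    have h2 := arcLoad_nonneg hr.nonneg path (Sum.inr (Sum.inl (t, !lay t))) t
    have h3 : (layeredState b x).demand t = max (-b t) 0 := rfl
    linarith
  · have h1 : ∑ t, (if P t then arcLoad m path' a t else 0) ≤
        ∑ t, (if q t ≤ β ∧ (layeredState b x).Own layerOf lay (Sum.inl (a, i)) t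
          then arcLoad m path (Sum.inl (a, i)) t else 0) +
        ∑ t, if P t then arcLoad m path (Sum.inl (a, !i)) t else 0 := by
      rw [← Finset.sum_add_distrib]
      refine Finset.sum_le_sum fun t _ => ?_
      by_cases ht : P t
      · obtain ⟨h2, h3, -⟩ := hP t ht
        rw [if_pos ht, if_pos ht, if_pos ⟨h3, (hown _ _).2 h2.symm⟩]
        exact hload a i t
      · rw [if_neg ht, if_neg ht, add_zero]
        split_ifs
        · exact arcLoad_nonneg hr.nonneg path _ t
        · exact le_rfl
    have hno : ∀ t, P t → ¬ (layeredState b x).Own layerOf lay (Sum.inl (a, !i)) t := by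
      intro t ht h
      have := (hown _ _).1 h
      rw [(hP t ht).1] at this
      simp [layerOf] at this
    have h2 := hr.own (Sum.inl (a, i)) β hβ
    have h3 : (layeredState b x).cap (Sum.inl (a, i)) = x a / 2 := by
      simp [FlowState.cap, layeredState]
    -- In the other layer at most one sink of the class uses the arc.
    have h4 : ∑ t, (if P t then arcLoad m path (Sum.inl (a, !i)) t else 0) ≤ γ := by
      refine sum_le_of_subsingleton hγ (fun t ht => ?_) (arcLoad_nonneg hr.nonneg path _)
        fun t t' ht ht' => hr.foreign _ t t' (hno t ht) (hno t' ht')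
      refine (hr.load_le_sub t (hnm t) _ fun h => hno t ht (Or.inr h)).trans (hP t ht).2.2
    linarith

end Layered

/-! ### From classes of sinks to feasible rounds -/

section Rounds

set_option linter.unusedSectionVars false

variable {V A : Type*} [Fintype V] [Fintype A] [DecidableEq V] [DecidableEq A]

/-- Ranks increase along the walk, so its arcs are distinct and membership agrees with multiplicity.
-/
theorem net_path {D : ArcDigraph V A} {ρ : V → ℕ} {s t : V} {p : List A} (h : D.IsWalk s t p)
    (hp : ∀ a ∈ p, ρ (D.src a) < ρ (D.tgt a)) (r : ℝ) (v : V) :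
    D.net (fun a => if a ∈ p then r else 0) v =
      (if s = v then r else 0) - if t = v then r else 0 := by
  have hnd : p.Nodup := (List.nodup_cons.1 (h.nodup_of_rank hp).1).2.of_map _
  have h1 : (fun a => if a ∈ p then r else 0) = fun a => r * (p.count a : ℝ) := by
    funext a
    by_cases ha : a ∈ p
    · simp [ha, List.count_eq_one_of_mem hnd ha]
    · simp [ha, List.count_eq_zero_of_not_mem ha]
  rw [h1, net_smul, h.net_count]
  split_ifs <;> ring

/-- A routing together with a partition of the sinks into classes that respect the capacities
yields feasible unsplittable rounds. -/
theorem routableInRounds_of_classes {D : ArcDigraph V A} {b : V → ℝ} {c : A → ℝ} {k : ℕ}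
    {ρ : V → ℕ} {m : V → V → ℝ} {path : V → V → List A} (cls : V → Fin k)
    (hm : ∀ s t, 0 ≤ m s t) (hrow : ∀ s, ∑ t, m s t = max (b s) 0)
    (hcol : ∀ t, ∑ s, m s t = max (-b t) 0)
    (hpath : ∀ s t, 0 < m s t → D.IsWalk s t (path s t) ∧
      ∀ a ∈ path s t, ρ (D.src a) < ρ (D.tgt a))
    (hcap : ∀ i a, ∑ t, (if cls t = i then arcLoad m path a t else 0) ≤ c a) :
    D.RoutableInRounds b c k := by
  have hsrc : ∀ s t, 0 < m s t → 0 < b s := by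
    intro s t h
    have h1 := Finset.single_le_sum (f := m s) (fun t' _ => hm s t') (Finset.mem_univ t)
    rw [hrow] at h1
    by_contra hs
    rw [max_eq_right (not_lt.1 hs)] at h1
    linarith
  have hsnk : ∀ s t, 0 < m s t → b t < 0 := by
    intro s t h
    have h1 := Finset.single_le_sum (f := fun s' => m s' t) (fun s' _ => hm s' t)
      (Finset.mem_univ s)
    rw [hcol] at h1
    by_contra ht
    rw [max_eq_right (by linarith)] at h1
    linarith
  have hz1 : ∀ s t, b s ≤ 0 → m s t = 0 := fun s t h =>
    le_antisymm (not_lt.1 fun h' => absurd (hsrc s t h') (not_lt.2 h)) (hm s t)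
  have hz2 : ∀ s t, 0 ≤ b t → m s t = 0 := fun s t h =>
    le_antisymm (not_lt.1 fun h' => absurd (hsnk s t h') (not_lt.2 h)) (hm s t)
  set amt : Fin k → V → V → ℝ := fun i s t => if cls t = i then m s t else 0 with hamt
  have hamt0 : ∀ i s t, 0 ≤ amt i s t := fun i s t => by
    simp only [hamt]; split_ifs; exacts [hm s t, le_rfl]
  have hamtpos : ∀ i s t, 0 < amt i s t → cls t = i ∧ 0 < m s t := fun i s t h => by
    simp only [hamt] at h
    split_ifs at h with h1
    · exact ⟨h1, h⟩
    · exact absurd h (lt_irrefl _)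
  -- Only vertices of positive balance send and only those of negative balance receive, so one of
  -- the two sums vanishes at every vertex.
  set bal : Fin k → V → ℝ := fun i v => ∑ t, amt i v t - ∑ s, amt i s v with hbal
  have hbal_snk : ∀ i t, b t ≤ 0 → bal i t = if cls t = i then b t else 0 := by
    intro i t ht
    have h1 : ∑ t', amt i t t' = 0 := Finset.sum_eq_zero fun t' _ => by simp [hamt, hz1 t t' ht]
    simp only [hbal, h1]
    simp only [hamt]
    split_ifs
    · rw [hcol, max_eq_left (by linarith)]; ring
    · simp
  have hbal_src : ∀ i s, 0 ≤ b s → bal i s = ∑ t, amt i s t := by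
    intro i s hs
    have h1 : ∑ s', amt i s' s = 0 := Finset.sum_eq_zero fun s' _ => by simp [hamt, hz2 s' s hs]
    simp only [hbal, h1, sub_zero]
  refine ⟨fun t => cls t, bal, fun i t => hbal_snk i t (le_of_lt t.2), fun i v hv => ?_,
    fun i s hs => ?_, fun s hs => ?_, fun i => ⟨⟨fun a => ∑ s, ∑ t,
      if a ∈ path s t then amt i s t else 0, ⟨fun a => ?_, fun v => ?_⟩, amt i, path, hamt0 i,
      fun s t hst => ?_, fun a => rfl⟩, fun a => ?_⟩⟩
  · rw [hbal_snk i v hv.le, hv]; simp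
  · rw [hbal_src i s (le_of_lt hs)]
    exact Finset.sum_nonneg fun t _ => hamt0 i s t
  · have h0 : 0 < b s := hs
    rw [Finset.sum_congr rfl fun i _ => hbal_src i s h0.le, Finset.sum_comm]
    simp only [hamt, Finset.sum_ite_eq, Finset.mem_univ, if_true]
    rw [hrow, max_eq_left h0.le]
  · exact Finset.sum_nonneg fun s _ => Finset.sum_nonneg fun t _ => by
      split_ifs; exacts [hamt0 i s t, le_rfl]
  · rw [← net_eq_sub, net_sum]
    have h1 : ∀ s t, D.net (fun a => if a ∈ path s t then amt i s t else 0) v =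
        (if s = v then amt i s t else 0) - if t = v then amt i s t else 0 := by
      intro s t
      rcases (hamt0 i s t).eq_or_lt with h | h
      · simp [← h, net]
      · obtain ⟨hw, hr⟩ := hpath s t (hamtpos i s t h).2
        exact net_path hw hr _ v
    simp only [net_sum, h1, Finset.sum_sub_distrib, hbal]
    congr 1
    · rw [Finset.sum_comm]; simp
    · simp
  · obtain ⟨hi, h1⟩ := hamtpos i s t hst
    obtain ⟨hw, hr⟩ := hpath s t h1
    refine ⟨?_, ?_, hw, (hw.nodup_of_rank hr).1⟩
    · change 0 < bal i s
      rw [hbal_src i s (hsrc s t h1).le]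
      exact hst.trans_le (Finset.single_le_sum (fun t' _ => hamt0 i s t') (Finset.mem_univ t))
    · change bal i t < 0
      rw [hbal_snk i t (hsnk s t h1).le, if_pos hi]
      exact hsnk s t h1
  · refine le_of_eq_of_le ?_ (hcap i a)
    dsimp only
    rw [Finset.sum_comm]
    refine Finset.sum_congr rfl fun t _ => ?_
    by_cases h : cls t = i
    · simp only [hamt, h, arcLoad, if_true]
      exact Finset.sum_congr rfl fun s _ => by congr
    · simp [hamt, h]

theorem dMax_nonneg (b : V → ℝ) : 0 ≤ dMax b := Real.iSup_nonneg fun _ => abs_nonneg _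

theorem max_neg_le_dMax (b : V → ℝ) (t : V) : max (-b t) 0 ≤ dMax b := by
  refine max_le ?_ (dMax_nonneg b)
  rcases lt_or_ge (b t) 0 with h | h
  · exact (neg_le_abs _).trans
      (le_ciSup (f := fun t : sinks b => |b t|) (Set.finite_range _).bddAbove ⟨t, h⟩)
  · linarith [dMax_nonneg b]

theorem cMin_le (c : A → ℝ) (a : A) : cMin c ≤ c a :=
  ciInf_le (Set.finite_range _).bddBelow a

/-- Two rounds suffice if the demands are at most a quarter of the capacities, and four rounds if
they are at most a third. -/
theorem routableInRounds_of_dMax_le {D : ArcDigraph V A} {b : V → ℝ} {c x : A → ℝ}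
    (hx : D.IsTransshipment b x) (hf : IsFeasible c x) {k : ℕ} :
    (dMax b ≤ cMin c / 4 → 2 ≤ k → D.RoutableInRounds b c k) ∧
    (dMax b ≤ cMin c / 3 → 4 ≤ k → D.RoutableInRounds b c k) := by
  classical
  obtain ⟨y, ρ, hy0, hyx, hynet, hρ⟩ := exists_acyclic_le D _ x hx.1 rfl
  obtain ⟨m, path, lay, q, hm, hrow, hcol, hpath, hq, hload⟩ :=
    exists_two_class_routing (b := b) hy0
      (fun v => by rw [hynet, net_eq_sub]; exact hx.2 v) hρ
  have hd := dMax_nonneg b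
  have hdem := max_neg_le_dMax b
  have hyc : ∀ a, y a ≤ c a := fun a => (hyx a).trans (hf a)
  constructor
  · intro h hk
    -- The rounds are the two layers, with β = γ = d_max: half of the capacity plus 2 d_max is at
    -- most the capacity. Any further rounds are empty.
    refine routableInRounds_of_classes
      (fun t => if lay t then (⟨0, by omega⟩ : Fin k) else ⟨1, by omega⟩) hm hrow hcol hpath
      fun i a => ?_
    have h1 := hload (fun t => (if lay t then (⟨0, by omega⟩ : Fin k) else ⟨1, by omega⟩) = i)
      (decide (i.1 = 0)) (dMax b) (dMax b) a hd hd (fun t ht => ⟨?_, ?_, ?_⟩)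
    · have h2 := hyc a
      have h3 := cMin_le c a
      refine le_trans (le_of_eq ?_) (h1.trans (by linarith))
      exact Finset.sum_congr rfl fun t _ => by congr
    · rw [← ht]; cases lay t <;> simp
    · exact (hq t).2.trans (hdem t)
    · linarith [(hq t).1, hdem t]
  · intro h hk
    -- Each layer is split at `q t` equal to half of the demand. In the even classes β = d_max/2 and
    -- γ = d_max, in the odd ones the converse holds; either way the excess is 3/2 d_max, at most
    -- half of c_min.
    set code : Bool → Prop → Fin k := fun l p =>
      if l then (if p then ⟨0, by omega⟩ else ⟨1, by omega⟩)
      else (if p then ⟨2, by omega⟩ else ⟨3, by omega⟩) with hcode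
    refine routableInRounds_of_classes (fun t => code (lay t) (q t ≤ max (-b t) 0 / 2))
      hm hrow hcol hpath fun i a => ?_
    have hlay : ∀ t, code (lay t) (q t ≤ max (-b t) 0 / 2) = i → lay t = decide (i.1 < 2) := by
      rintro t rfl
      cases lay t <;> by_cases hp : q t ≤ max (-b t) 0 / 2 <;> simp [hcode, hp]
    have hpar : ∀ t, code (lay t) (q t ≤ max (-b t) 0 / 2) = i →
        (q t ≤ max (-b t) 0 / 2 ↔ i.1 % 2 = 0) := by
      rintro t rfl
      cases lay t <;> by_cases hp : q t ≤ max (-b t) 0 / 2 <;> simp [hcode, hp]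
    have h2 := hyc a
    have h3 := cMin_le c a
    have key : ∑ t, (if code (lay t) (q t ≤ max (-b t) 0 / 2) = i then arcLoad m path a t else 0) ≤
        y a / 2 + 3 / 2 * dMax b := by
      by_cases hi : i.1 % 2 = 0
      · have h1 := hload (fun t => code (lay t) (q t ≤ max (-b t) 0 / 2) = i)
          (decide (i.1 < 2)) (dMax b / 2) (dMax b) a (by linarith) hd
          (fun t ht => ⟨hlay t ht, ?_, ?_⟩)
        · refine le_trans (le_of_eq ?_) (h1.trans (by linarith))
          exact Finset.sum_congr rfl fun t _ => by congr
        · linarith [(hpar t ht).2 hi, hdem t]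
        · linarith [(hq t).1, hdem t]
      · have h1 := hload (fun t => code (lay t) (q t ≤ max (-b t) 0 / 2) = i)
          (decide (i.1 < 2)) (dMax b) (dMax b / 2) a hd (by linarith)
          (fun t ht => ⟨hlay t ht, ?_, ?_⟩)
        · refine le_trans (le_of_eq ?_) (h1.trans (by linarith))
          exact Finset.sum_congr rfl fun t _ => by congr
        · exact (hq t).2.trans (hdem t)
        · have := fun hh => hi ((hpar t ht).1 hh)
          linarith [not_le.1 this, hdem t]
    linarith

end Rounds

end ArcDigraph

theorem mainTheorem8 {V A : Type*} [Fintype V] [Fintype A] [DecidableEq V] [DecidableEq A]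
    (D : ArcDigraph V A) (b : V → ℝ) (hb : ∑ v, b v = 0)
    (c : A → ℝ) (hc : ∀ a, 0 ≤ c a)
    (hx : ∃ x : A → ℝ, D.IsTransshipment b x ∧ ArcDigraph.IsFeasible c x) :
    (ArcDigraph.dMax b ≤ ArcDigraph.cMin c / 3 → D.RoutableInRounds b c 6) ∧
    (ArcDigraph.dMax b ≤ ArcDigraph.cMin c / 4 → D.RoutableInRounds b c 4) := by
  obtain ⟨x, hx, hf⟩ := hx
  exact ⟨fun h => (ArcDigraph.routableInRounds_of_dMax_le hx hf).2 h (by norm_num),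
    fun h => (ArcDigraph.routableInRounds_of_dMax_le hx hf).1 h (by norm_num)⟩
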